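/- Let $(X,\mathcal R,X^\vee,\mathcal R^\vee)$ be a reduced root datum ($X$, $X^\vee$ free abelian groups of finite rank in duality, $\mathcal R\subset X$ finite) with Weyl group $W$ and a fixed basis of simple roots; for example the root datum of a compact connected Lie group $G$ with maximal torus $T$ and $X=\mathrm{Hom}(T,U(1))$. Let $R(T)=\mathbb Z[X]$ be the group ring, with basis $(e^\lambda)_{\lambda\in X}$ and $W$-action $w(e^\lambda)=e^{w(\lambda)}$, and let $R(T)^W$ be the subring of invariants (canonically isomorphic to the representation ring $R(G)$ in the example). For $\alpha\in\mathcal R$ let $\delta_\alpha\in\mathrm{End}_{R(T)^W}(R(T))$ be the operator $$\delta_\alpha(u)=\frac{u-e^{-\alpha}s_\alpha(u)}{1-e^{-\alpha}},$$ and let $\mathcal D\subset\mathrm{End}_{R(T)^W}(R(T))$ be the $R(T)^W$-subalgebra generated by all $\delta_\alpha$, $\alpha\in\mathcal R$, and by the multiplication operators by elements of $R(T)$; it contains $W$. Let $I(\mathcal D)=\{\Delta\in\mathcal D\mid\Delta(1)=0\}$. Let $w_0$ be the longest element of $W$, and let $\partial_{w_0}=\delta_{\beta_1}\cdots\delta_{\beta_N}\in\mathcal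 D$, where $w_0=s_{\beta_1}\cdots s_{\beta_N}$ is any reduced expression in simple reflections. For a left $\mathcal D$-module $A$ and a left ideal $L$ of $\mathcal D$ put $A^L=\{a\in A\mid\Delta a=0\text{ for all }\Delta\in L\}$ and $A^W=\{a\in A\mid wa=a\text{ for all }w\in W\}$; these are $R(T)^W$-submodules of $A$. Then $\partial_{w_0}(1)=1$. Let $u_0\in R(T)$ be any element with $\partial_{w_0}(u_0)=1$, and define $\pi\in\mathcal D$ by $\pi(u)=\partial_{w_0}(u_0u)$. Then $$\mathcal J=\mathcal D\cdot\pi+\sum_{w\in W}\mathcal D\cdot(1-w)$$ is the left ideal of $\mathcal D$ generated by $\pi$ and the image of the augmentation ideal of $\mathbb Z[W]$, and for every left $\mathcal D$-module $A$: 1. $\pi\colon A\to A$ is a projection of $A$ onto the $R(T)^W$-submodule $A^{I(\mathcal D)}$, i.e. $\pi(A)\subset A^{I(\mathcal D)}$ and $\pi(a)=a$ for all $a\in A^{I(\mathcal D)}$. 2. $A^W=A^{I(\mathcal D)}\oplus A^{\mathcal J}$. Hence $A^W=A^{I(\mathcal D)}$ if and only if $A^{\mathcal J}=0$. -/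

import Mathlib

noncomputable section

namespace DemazureHecke

/-- The group ring `ℤ[X]` of the character lattice `X`, i.e. the representation ring `R(T)` of the
torus with character group `X`. -/
abbrev CharRing (X : Type*) [AddCommGroup X] : Type _ := AddMonoidAlgebra ℤ X

/-- The basis element `e^l` of `ℤ[X]`. -/
def ex {X : Type*} [AddCommGroup X] (l : X) : CharRing X := AddMonoidAlgebra.single l 1

section Basics

variable {X : Type*} [AddCommGroup X]

theorem ex_zero : ex (0 : X) = 1 := rfl

theorem ex_add (l m : X) : ex (l + m) = ex l * ex m := by
  simp [ex, AddMonoidAlgebra.single_mul_single]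

theorem one_sub_ex_ne_zero {a : X} (ha : a ≠ 0) : (1 : CharRing X) - ex a ≠ 0 := by
  intro h
  rw [sub_eq_zero, ← ex_zero] at h
  have := (AddMonoidAlgebra.single_left_injective (R := ℤ) (M := X) one_ne_zero) h
  exact ha this.symm

/-- `1 - e^a` divides `1 - e^{na}` for every integer `n`. -/
theorem one_sub_ex_dvd (a : X) (n : ℤ) : (1 : CharRing X) - ex a ∣ 1 - ex (n • a) := by
  have hnat : ∀ k : ℕ, (1 : CharRing X) - ex a ∣ 1 - ex ((k : ℤ) • a) := by
    intro k
    induction k with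
    | zero => simp [ex_zero]
    | succ k ih =>
      have h : (1 : CharRing X) - ex (((k + 1 : ℕ) : ℤ) • a)
          = (1 - ex ((k : ℤ) • a)) + ex ((k : ℤ) • a) * (1 - ex a) := by
        push_cast
        rw [add_smul, one_smul, ex_add]
        ring
      rw [h]
      exact dvd_add ih (dvd_mul_left _ _)
  obtain ⟨k, rfl | rfl⟩ := n.eq_nat_or_neg
  · exact hnat k
  · have h : (1 : CharRing X) - ex ((-(k : ℤ)) • a)
        = - ex ((-(k : ℤ)) • a) * (1 - ex ((k : ℤ) • a)) := by
      have h1 : ex ((-(k : ℤ)) • a) * ex ((k : ℤ) • a) = (1 : CharRing X) := by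
        rw [← ex_add, ← add_smul, neg_add_cancel, zero_smul, ex_zero]
      rw [mul_sub, neg_mul, neg_mul, h1]
      ring
    rw [h]
    exact (hnat k).mul_left _

theorem noZeroDivisors [Module.Free ℤ X] : NoZeroDivisors (CharRing X) := by
  let e := (Module.Free.chooseBasis ℤ X).repr
  have : UniqueSums X := UniqueSums.of_injective_addHom
    (AddMonoidHomClass.toAddMonoidHom e : X →+ _).toAddHom e.injective inferInstance
  infer_instance

end Basics

section Weyl

variable {ι X Y : Type*} [AddCommGroup X] [AddCommGroup Y]

/-- The action of the Weyl group on `ℤ[X]` by ring automorphisms, `w(e^l) = e^{w(l)}`. -/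
def weylAct (P : RootDatum ι X Y) : P.weylGroup →* (CharRing X →ₐ[ℤ] CharRing X) where
  toFun w := AddMonoidAlgebra.mapDomainAlgHom ℤ ℤ (DistribSMul.toAddMonoidHom X w)
  map_one' := by
    ext x
    simp
  map_mul' v w := by
    ext x
    simp [mul_smul]

theorem weylAct_ex (P : RootDatum ι X Y) (w : P.weylGroup) (l : X) :
    weylAct P w (ex l) = ex (w • l) := by
  simp [weylAct, ex]

/-- The ring `ℤ[X]^W` of Weyl invariants (for `ℤ[X] = R(T)` this is the image of `R(G)`). -/
def invariantRing (P : RootDatum ι X Y) : Subalgebra ℤ (CharRing X) where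
  carrier := {u | ∀ w : P.weylGroup, weylAct P w u = u}
  mul_mem' ha hb w := by rw [map_mul, ha w, hb w]
  add_mem' ha hb w := by rw [map_add, ha w, hb w]
  algebraMap_mem' r w := by simp

/-- The algebra `E` of `ℤ[X]^W`-linear endomorphisms of `ℤ[X]`. -/
abbrev EndRing (P : RootDatum ι X Y) : Type _ := Module.End (invariantRing P) (CharRing X)

/-- The reflection in the `i`-th root, as an element of the Weyl group. -/
abbrev refl (P : RootDatum ι X Y) (i : ι) : P.weylGroup := RootPairing.weylGroup.ofIdx P i

/-- For every root `a` and every `u`, the element `u - e^{-a} s_a(u)` is divisible by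
`1 - e^{-a}`. -/
theorem exists_quotient (P : RootDatum ι X Y) (i : ι) (u : CharRing X) :
    ∃ v : CharRing X, (1 - ex (-P.root i)) * v = u - ex (-P.root i) * weylAct P (refl P i) u := by
  suffices h : (1 : CharRing X) - ex (-P.root i) ∣ u - ex (-P.root i) * weylAct P (refl P i) u by
    obtain ⟨v, hv⟩ := h
    exact ⟨v, hv.symm⟩
  induction u using AddMonoidAlgebra.induction_linear with
  | zero => simp
  | add f g hf hg =>
    rw [map_add, mul_add, add_sub_add_comm]
    exact dvd_add hf hg
  | single l n =>
    have h1 : (AddMonoidAlgebra.single l n : CharRing X) = n • ex l := by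
      simp [ex, AddMonoidAlgebra.smul_single]
    have h2 : refl P i • l = l - P.toLinearMap l (P.coroot i) • P.root i := by
      rw [RootPairing.weylGroup.ofIdx_smul]
      exact P.reflection_apply i l
    have h3 : (ex l : CharRing X) - ex (-P.root i) * weylAct P (refl P i) (ex l)
        = ex l * (1 - ex ((P.toLinearMap l (P.coroot i) + 1) • (-P.root i))) := by
      rw [weylAct_ex, h2, mul_sub, mul_one, ← ex_add, ← ex_add]
      congr 2
      module
    rw [h1, map_zsmul, mul_smul_comm, ← smul_sub, h3]
    exact ((one_sub_ex_dvd _ _).mul_left _).trans (by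
      rw [zsmul_eq_mul]; exact dvd_mul_left _ _)

variable [Module.Free ℤ X]

/-- Quotients by `1 - e^{-a}` are unique. -/
theorem denom_cancel (P : RootDatum ι X Y) (i : ι) {u v : CharRing X}
    (h : (1 - ex (-P.root i)) * u = (1 - ex (-P.root i)) * v) : u = v := by
  have : NoZeroDivisors (CharRing X) := noZeroDivisors
  have : IsDomain (CharRing X) := NoZeroDivisors.to_isDomain _
  exact mul_left_cancel₀ (one_sub_ex_ne_zero (neg_ne_zero.mpr (P.ne_zero i))) h

/-- Demazure's isobaric divided difference operator
`δ_a(u) = (u - e^{-a} s_a(u)) / (1 - e^{-a})` for the `i`-th root `a`. It is characterised by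
`denom_mul_divDiff` below. -/
def divDiff (P : RootDatum ι X Y) (i : ι) : EndRing P where
  toFun u := (exists_quotient P i u).choose
  map_add' u v := by
    apply denom_cancel P i
    rw [mul_add, (exists_quotient P i _).choose_spec, (exists_quotient P i _).choose_spec,
      (exists_quotient P i _).choose_spec, map_add]
    ring
  map_smul' r u := by
    apply denom_cancel P i
    rw [RingHom.id_apply, mul_smul_comm, (exists_quotient P i _).choose_spec,
      (exists_quotient P i _).choose_spec, Subalgebra.smul_def, smul_eq_mul, map_mul,
      r.2 (refl P i), Subalgebra.smul_def, smul_eq_mul]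
    ring

theorem denom_mul_divDiff (P : RootDatum ι X Y) (i : ι) (u : CharRing X) :
    (1 - ex (-P.root i)) * divDiff P i u = u - ex (-P.root i) * weylAct P (refl P i) u :=
  (exists_quotient P i u).choose_spec

/-- The Hecke algebra `D`: the subalgebra of `E` generated by the operators `δ_a` for all roots `a`
and by the multiplication operators by elements of `ℤ[X]`. -/
def hecke (P : RootDatum ι X Y) : Subalgebra (invariantRing P) (EndRing P) :=
  Algebra.adjoin (invariantRing P)
    (Set.range (divDiff P) ∪ Set.range (Algebra.lmul (invariantRing P) (CharRing X)))

/-- `δ_a` as an element of `D`. -/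
def divDiffD (P : RootDatum ι X Y) (i : ι) : hecke P :=
  ⟨divDiff P i, Algebra.subset_adjoin (Or.inl ⟨i, rfl⟩)⟩

/-- Multiplication by `u` as an element of `D`. -/
def mulD (P : RootDatum ι X Y) (u : CharRing X) : hecke P :=
  ⟨Algebra.lmul (invariantRing P) (CharRing X) u, Algebra.subset_adjoin (Or.inr ⟨u, rfl⟩)⟩

/-- The Weyl group acting on `ℤ[X]` by `ℤ[X]^W`-linear endomorphisms. -/
def weylEnd (P : RootDatum ι X Y) : P.weylGroup →* EndRing P where
  toFun w :=
    { toFun := weylAct P w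
      map_add' := map_add _
      map_smul' := fun r u => by
        simp only [Subalgebra.smul_def, smul_eq_mul, map_mul, RingHom.id_apply]
        rw [r.2 w] }
  map_one' := by ext1 u; simp
  map_mul' v w := by ext1 u; simp

theorem weylEnd_refl_mem (P : RootDatum ι X Y) (i : ι) : weylEnd P (refl P i) ∈ hecke P := by
  have h : weylEnd P (refl P i) =
      (mulD P (ex (P.root i)) * (1 - mulD P (1 - ex (-P.root i)) * divDiffD P i) : hecke P) := by
    ext1 u
    change weylAct P (refl P i) u =
      ex (P.root i) * (u - (1 - ex (-P.root i)) * divDiff P i u)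
    rw [denom_mul_divDiff, sub_sub_cancel, ← mul_assoc, ← ex_add, add_neg_cancel, ex_zero, one_mul]
  rw [h]
  exact Subtype.property _

theorem weylEnd_mem (P : RootDatum ι X Y) (w : P.weylGroup) : weylEnd P w ∈ hecke P := by
  obtain ⟨g, hg⟩ := w
  induction hg using RootPairing.weylGroup.induction with
  | mem i => exact weylEnd_refl_mem P i
  | one => exact (map_one (weylEnd P)).symm ▸ one_mem (hecke P)
  | mul g₁ g₂ hg₁ hg₂ h₁ h₂ =>
    have h := mul_mem h₁ h₂
    rw [← MonoidHom.map_mul] at h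
    exact h

/-- The embedding of the Weyl group in `D`. -/
def weylD (P : RootDatum ι X Y) : P.weylGroup →* hecke P where
  toFun w := ⟨weylEnd P w, weylEnd_mem P w⟩
  map_one' := Subtype.ext (map_one _)
  map_mul' v w := Subtype.ext (map_mul _ v w)

/-- The augmentation left ideal `I(D)`, the annihilator in `D` of `1 ∈ ℤ[X]`. (`Ideal` means left
ideal over a noncommutative ring.) -/
def augIdeal (P : RootDatum ι X Y) : Ideal (hecke P) where
  carrier := {Δ | (Δ : EndRing P) 1 = 0}
  add_mem' {a b} ha hb := by
    have ha' : (a : EndRing P) 1 = 0 := ha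
    have hb' : (b : EndRing P) 1 = 0 := hb
    change (a : EndRing P) 1 + (b : EndRing P) 1 = 0
    rw [ha', hb', add_zero]
  zero_mem' := rfl
  smul_mem' c a ha := by
    have ha' : (a : EndRing P) 1 = 0 := ha
    change (c : EndRing P) ((a : EndRing P) 1) = 0
    rw [ha', map_zero]

/-- The augmentation ideal `I(W)` of the integral group ring of a group `W`, i.e. the kernel of the
ring homomorphism `ℤ[W] → ℤ` sending every `w ∈ W` to `1`. -/
def groupAugIdeal (W : Type*) [Group W] : Ideal (MonoidAlgebra ℤ W) :=
  RingHom.ker (MonoidAlgebra.lift ℤ ℤ W (1 : W →* ℤ))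

/-- The ring homomorphism `ℤ[W] → D` extending the embedding of `W`. -/
def groupRingD (P : RootDatum ι X Y) : MonoidAlgebra ℤ P.weylGroup →ₐ[ℤ] hecke P :=
  MonoidAlgebra.lift ℤ (hecke P) P.weylGroup (weylD P)

/-- The left ideal `J = D·π + ∑_w D·(1 - w)` of `D`. -/
def idealJ (P : RootDatum ι X Y) (π : hecke P) : Ideal (hecke P) :=
  Ideal.span {π} ⊔ ⨆ w : P.weylGroup, Ideal.span {1 - weylD P w}

/-- `A^L`: the `ℤ[X]^W`-submodule of the elements of `A` annihilated by the left ideal `L`. -/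
def annihilatedBy (P : RootDatum ι X Y) (L : Ideal (hecke P)) (A : Type*) [AddCommGroup A]
    [Module (hecke P) A] [Module (invariantRing P) A]
    [IsScalarTower (invariantRing P) (hecke P) A] : Submodule (invariantRing P) A where
  carrier := {a | ∀ Δ ∈ L, Δ • a = 0}
  add_mem' ha hb Δ hΔ := by rw [smul_add, ha Δ hΔ, hb Δ hΔ, add_zero]
  zero_mem' Δ _ := smul_zero Δ
  smul_mem' r a ha Δ hΔ := by
    rw [← algebraMap_smul (hecke P) r a, smul_smul, ← Algebra.commutes, ← smul_smul, ha Δ hΔ,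
      smul_zero]

/-- `A^W`: the `ℤ[X]^W`-submodule of Weyl invariant elements of `A`. -/
def weylInvariants (P : RootDatum ι X Y) (A : Type*) [AddCommGroup A]
    [Module (hecke P) A] [Module (invariantRing P) A]
    [IsScalarTower (invariantRing P) (hecke P) A] : Submodule (invariantRing P) A where
  carrier := {a | ∀ w : P.weylGroup, weylD P w • a = a}
  add_mem' ha hb w := by rw [smul_add, ha w, hb w]
  zero_mem' w := smul_zero _
  smul_mem' r a ha w := by
    rw [← algebraMap_smul (hecke P) r a, smul_smul, ← Algebra.commutes, ← smul_smul, ha w]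

end Weyl

section Words

variable {ι X Y : Type*} [AddCommGroup X] [AddCommGroup Y] {P : RootDatum ι X Y}

/-- The product `s_{β₁} ⋯ s_{βₗ}` of the simple reflections in a word of simple roots. -/
def wordProd (b : P.Base) (l : List b.support) : P.weylGroup :=
  (l.map fun i => RootPairing.weylGroup.ofIdx P i).prod

/-- The length of a Weyl group element with respect to the simple reflections. -/
def length (b : P.Base) (w : P.weylGroup) : ℕ :=
  sInf {n | ∃ l : List b.support, wordProd b l = w ∧ l.length = n}

/-- `l` is a reduced expression of `w` in terms of simple reflections. -/
def IsReducedWord (b : P.Base) (l : List b.support) (w : P.weylGroup) : Prop :=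
  wordProd b l = w ∧ l.length = length b w

/-- `w` is the longest element of the Weyl group. -/
def IsLongest (b : P.Base) (w : P.weylGroup) : Prop :=
  ∀ v : P.weylGroup, length b v ≤ length b w

/-- The composition `δ_{β₁} ⋯ δ_{βₗ}` along a word of simple roots, as an element of `D`. For a
reduced expression of `w` this is the operator `∂_w`. -/
def demazure [Module.Free ℤ X] (b : P.Base) (l : List b.support) : hecke P :=
  (l.map fun i => divDiffD P i).prod

/-- The operator `π(u) = ∂(u₀ u)` in `D`, where `∂` is the composition of the divided differences
along the word `l`. -/
def projOp [Module.Free ℤ X] (b : P.Base) (l : List b.support) (u₀ : CharRing X) : hecke P :=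
  demazure b l * mulD P u₀

theorem projOp_apply [Module.Free ℤ X] (b : P.Base) (l : List b.support) (u₀ u : CharRing X) :
    (projOp b l u₀ : EndRing P) u = (demazure b l : EndRing P) (u₀ * u) := rfl

end Words

end DemazureHecke

end

noncomputable section

namespace DemazureHecke

/-! ### Lengths and exchange in the Weyl group -/

section WeylGroup

variable {ι X Y : Type*} [AddCommGroup X] [AddCommGroup Y] {P : RootDatum ι X Y}

/-! Everything rests on one fact: `∂_{w₀}` maps `R(T)` into `R(T)^W` (`demazure_mem_invariantRing`).
An element `Δ` of `I(D)` is `R(T)^W`-linear and kills `1`, hence kills all invariants, so `Δ π = 0`.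
Also `π(1) = ∂_{w₀}(u₀) = 1`, so `1 - π ∈ I(D)`. These two relations in `D` make `π` act on every
module as a projection onto `A^{I(D)}`. Since `1 - w ∈ I(D)`, this submodule lies in `A^W`, while
`A^J` is the kernel of `π` on `A^W`; then `a = πa + (a - πa)` is the required splitting.

For the invariance, the image of `δ_a` is fixed by `s_a`, so it is enough to write `∂_{w₀}` with any
prescribed simple `δ_a` on the left. The longest element has a reduced word with any prescribed
first letter, and `∂_w` is independent of the reduced word (`demazure_eq_of_isReducedWord`). That
independence is Matsumoto's argument, based on the exchange property `exists_exchange` and on the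
braid relations for the `δ_a`.

The braid relations are checked in the fraction field of `ℤ[X]`. With `G_γ = 1/(1 - e^{-γ})`, both
alternating products of `δ_α` and `δ_β` equal `x ↦ ∑ w((∏ G_γ) x)`, where `w` runs over the dihedral
group generated by `s_α`, `s_β` and `γ` over its positive roots. This is Demazure's character
formula in rank two, and it is symmetric in `α` and `β`. -/

theorem root_smul (w : P.weylGroup) (i : ι) : P.root (w • i) = w • P.root i :=
  RootPairing.Equiv.root_indexEquiv_eq_smul P i (w : P.Aut)

theorem refl_smul (i : ι) (x : X) : refl P i • x = x - P.toLinearMap x (P.coroot i) • P.root i :=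
  P.reflection_apply i x

theorem refl_smul_root (i j : ι) : refl P i • P.root j = P.root j - P.pairing j i • P.root i :=
  refl_smul i _

theorem refl_smul_idx (i j : ι) : refl P i • j = P.reflectionPerm i j := rfl

theorem weyl_ext {v w : P.weylGroup} (h : ∀ x : X, v • x = w • x) : v = w :=
  Subtype.ext (RootPairing.Equiv.weightHom_injective P (LinearEquiv.ext h))

theorem refl_mul_self (i : ι) : refl P i * refl P i = 1 :=
  weyl_ext fun x => by
    rw [mul_smul, one_smul]
    exact P.reflection_same i x

theorem refl_inv (i : ι) : (refl P i)⁻¹ = refl P i :=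
  inv_eq_of_mul_eq_one_left (refl_mul_self i)

theorem refl_mul_refl_mul (i : ι) (w : P.weylGroup) : refl P i * (refl P i * w) = w := by
  rw [← mul_assoc, refl_mul_self, one_mul]

theorem refl_reflectionPerm (i j : ι) :
    refl P (P.reflectionPerm i j) = refl P i * (refl P j * refl P i) :=
  weyl_ext fun x => by
    rw [mul_smul, mul_smul]
    change P.reflection _ x = P.reflection i (P.reflection j (P.reflection i x))
    rw [P.reflection_reflectionPerm]
    rfl

variable (b : P.Base)

theorem wordProd_nil : wordProd b [] = 1 := rfl

theorem wordProd_cons (i : b.support) (l : List b.support) :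
    wordProd b (i :: l) = refl P i * wordProd b l := by
  simp [wordProd]

theorem wordProd_append (l m : List b.support) :
    wordProd b (l ++ m) = wordProd b l * wordProd b m := by
  simp [wordProd]

variable [Finite ι] [P.IsReduced]

/-- The Weyl group is generated by the simple reflections. -/
theorem exists_wordProd_eq (w : P.weylGroup) : ∃ l, wordProd b l = w := by
  have hrefl (i : ι) : ∃ l, wordProd b l = refl P i := by
    induction i using b.induction_reflect with
    | h₀ i h =>
      obtain ⟨l, hl⟩ := h
      exact ⟨l, by rw [hl, refl_reflectionPerm, refl_mul_refl_mul]⟩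
    | h₁ i hi => exact ⟨[⟨i, hi⟩], by simp [wordProd]⟩
    | h₂ i j h hj =>
      obtain ⟨l, hl⟩ := h
      refine ⟨⟨j, hj⟩ :: (l ++ [⟨j, hj⟩]), ?_⟩
      rw [wordProd_cons, wordProd_append, hl, refl_reflectionPerm, wordProd_cons, wordProd_nil,
        mul_one]
  obtain ⟨g, hg⟩ := w
  induction hg using RootPairing.weylGroup.induction with
  | mem i => exact hrefl i
  | one => exact ⟨[], rfl⟩
  | mul g₁ g₂ hg₁ hg₂ h₁ h₂ =>
    obtain ⟨l₁, h₁⟩ := h₁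
    obtain ⟨l₂, h₂⟩ := h₂
    exact ⟨l₁ ++ l₂, by rw [wordProd_append, h₁, h₂]; rfl⟩

theorem exists_isReducedWord (w : P.weylGroup) : ∃ l, IsReducedWord b l w := by
  obtain ⟨l, hl⟩ := exists_wordProd_eq b w
  exact Nat.sInf_mem (s := {n | ∃ l : List b.support, wordProd b l = w ∧ l.length = n})
    ⟨_, l, hl, rfl⟩

omit [Finite ι] [P.IsReduced] in
theorem length_wordProd_le (l : List b.support) : length b (wordProd b l) ≤ l.length :=
  Nat.sInf_le ⟨l, rfl, rfl⟩

theorem length_refl_mul_le (i : b.support) (w : P.weylGroup) :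
    length b (refl P i * w) ≤ length b w + 1 := by
  obtain ⟨l, rfl, h⟩ := exists_isReducedWord b w
  rw [← wordProd_cons, ← h]
  exact length_wordProd_le b (i :: l)

/-- The exchange property: if `w⁻¹` makes a positive root `γ` negative, then `s_γ w` has a shorter
expression than `w`. -/
theorem exists_exchange (l : List b.support) (k : ι) (hk : b.IsPos k)
    (hneg : ¬ b.IsPos ((wordProd b l)⁻¹ • k)) :
    ∃ l', wordProd b l' = refl P k * wordProd b l ∧ l'.length < l.length := by
  induction l generalizing k with
  | nil => simp [wordProd_nil, hk] at hneg
  | cons j l ih =>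
    by_cases hjk : k = j
    · exact ⟨l, by rw [wordProd_cons, hjk, refl_mul_refl_mul], by simp⟩
    · rw [wordProd_cons, mul_inv_rev, refl_inv, mul_smul, refl_smul_idx] at hneg
      -- A simple reflection `s_j` keeps positive every positive root other than `α_j`, so the
      -- induction hypothesis applies to `s_j γ`; conjugating by `s_j` returns to `γ`.
      obtain ⟨l', hl', hlen⟩ := ih _ (hk.reflectionPerm j.2 hjk) hneg
      refine ⟨j :: l', ?_, by simpa using hlen⟩
      rw [wordProd_cons, hl', refl_reflectionPerm, wordProd_cons]
      simp only [mul_assoc, refl_mul_refl_mul]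

theorem length_refl_mul_of_not_isPos {i : b.support} {w : P.weylGroup}
    (h : ¬ b.IsPos (w⁻¹ • (i : ι))) : length b w = length b (refl P i * w) + 1 := by
  have h₁ := length_refl_mul_le b i (refl P i * w)
  rw [refl_mul_refl_mul] at h₁
  obtain ⟨l, rfl, hl⟩ := exists_isReducedWord b w
  obtain ⟨l', h', hlen⟩ := exists_exchange b l i (b.isPos_of_mem_support i.2) h
  have h₂ := length_wordProd_le b l'
  rw [h'] at h₂
  omega

omit [P.IsReduced] [Finite ι] in
-- Since `s_i α_i = -α_i`, the two roots compared are negatives of each other.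
theorem isPos_refl_smul_iff (w : P.weylGroup) (i : ι) :
    b.IsPos ((refl P i * w)⁻¹ • i) ↔ ¬ b.IsPos (w⁻¹ • i) := by
  have h : (refl P i * w)⁻¹ • i = P.reflectionPerm (w⁻¹ • i) (w⁻¹ • i) := by
    apply P.root.injective
    rw [mul_inv_rev, refl_inv, mul_smul, root_smul, root_smul, refl_smul_root, P.pairing_same,
      P.root_reflectionPerm, P.reflection_apply_self, root_smul, ← smul_neg]
    congr 1
    module
  rw [h]
  exact RootPairing.Base.IsPos.neg_iff_not b _

/-- A weak inequality suffices: if `w⁻¹ α_i` were positive, `s_i w` would be longer than `w` by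
exactly one. -/
theorem not_isPos_of_length_refl_mul_lt {i : b.support} {w : P.weylGroup}
    (h : length b (refl P i * w) ≤ length b w) : ¬ b.IsPos (w⁻¹ • (i : ι)) := by
  intro hpos
  have h' : ¬ b.IsPos ((refl P i * w)⁻¹ • (i : ι)) := by
    rw [isPos_refl_smul_iff]
    exact not_not.mpr hpos
  have := length_refl_mul_of_not_isPos b h'
  rw [refl_mul_refl_mul] at this
  omega

omit [P.IsReduced] [Finite ι] in
theorem height_eq_of_root_eq {i j k : ι} {x y : ℕ}
    (h : P.root k = x • P.root i + y • P.root j) :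
    b.height k = x * b.height i + y * b.height j := by
  obtain ⟨f, -, -, hf⟩ := b.exists_root_eq_sum_int i
  obtain ⟨g, -, -, hg⟩ := b.exists_root_eq_sum_int j
  have hfg : P.root k = ∑ l ∈ b.support, ((x : ℤ) • f + (y : ℤ) • g) l • P.root l := by
    simp_rw [Pi.add_apply, Pi.smul_apply, add_smul, smul_assoc, Finset.sum_add_distrib,
      ← Finset.smul_sum, ← hf, ← hg, h, natCast_zsmul]
  rw [RootPairing.Base.height_eq_sum hf, RootPairing.Base.height_eq_sum hg,
    RootPairing.Base.height_eq_sum hfg]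
  simp [Finset.sum_add_distrib, Finset.mul_sum]

omit [P.IsReduced] [Finite ι] in
-- Positivity is the sign of the height, which is additive, so a root in the cone spanned by two
-- roots that `w` makes negative is made negative too.
theorem not_isPos_smul_of_root_eq {w : P.weylGroup} {i j k : ι} {x y : ℕ}
    (hi : ¬ b.IsPos (w • i)) (hj : ¬ b.IsPos (w • j))
    (h : P.root k = x • P.root i + y • P.root j) : ¬ b.IsPos (w • k) := by
  have h' : P.root (w • k) = x • P.root (w • i) + y • P.root (w • j) := by
    rw [root_smul, h, root_smul, root_smul, smul_add, smul_comm w x, smul_comm w y]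
  rw [RootPairing.Base.isPos_iff, not_lt] at *
  rw [height_eq_of_root_eq b h']
  have hx := mul_nonpos_of_nonneg_of_nonpos (Int.natCast_nonneg x) hi
  have hy := mul_nonpos_of_nonneg_of_nonpos (Int.natCast_nonneg y) hj
  omega

/-- The roots `g s_{i₁} ⋯ s_{i_{k-1}} α_{i_k}` attached to a word are nonnegative combinations of
two given roots. -/
def InversionsNonneg (i j : ι) : P.weylGroup → List b.support → Prop
  | _, [] => True
  | g, k :: l => (∃ x y : ℕ, g • P.root k = x • P.root i + y • P.root j) ∧
      InversionsNonneg i j (g * refl P k) l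

/-- If `w⁻¹` makes `α_i` and `α_j` negative, it makes negative every root attached to `c`. Hence
each letter of `c` stripped from the left lowers the length by one, and `w` has a reduced word
starting with `c` (case `g = 1`). -/
theorem length_eq_of_inversionsNonneg {i j : ι} {w : P.weylGroup}
    (hi : ¬ b.IsPos (w⁻¹ • i)) (hj : ¬ b.IsPos (w⁻¹ • j)) (g : P.weylGroup) (c : List b.support)
    (hc : InversionsNonneg b i j g c) :
    length b (g⁻¹ * w) = c.length + length b ((wordProd b c)⁻¹ * (g⁻¹ * w)) := by
  induction c generalizing g with
  | nil => simp [wordProd_nil]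
  | cons k l ih =>
    obtain ⟨⟨x, y, h⟩, hl⟩ := hc
    rw [← root_smul] at h
    have hk := not_isPos_smul_of_root_eq b hi hj h
    rw [← mul_smul] at hk
    have h₁ := length_refl_mul_of_not_isPos b (i := k) (w := g⁻¹ * w)
      (by rwa [mul_inv_rev, inv_inv])
    have h₂ := ih _ hl
    rw [mul_inv_rev, refl_inv, mul_assoc] at h₂
    rw [h₁, h₂, wordProd_cons, mul_inv_rev, refl_inv, List.length_cons]
    simp only [mul_assoc]
    omega

end WeylGroup

/-! ### Alternating products of two operators as sums over a dihedral group -/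

section RankTwo

variable {K : Type*} [Field K]

/-- The operator `x ↦ G x + s(G x)` on a field; for `G = 1 / (1 - e^{-a})` and `s = s_a` this is
the operator `δ_a`. -/
def symOp (s : K →+* K) (G x : K) : K := G * x + s (G * x)

theorem symOp_add (s : K →+* K) (G x y : K) : symOp s G (x + y) = symOp s G x + symOp s G y := by
  simp only [symOp, mul_add, map_add]
  ring

/-- Over a translate `u` of the wall, `symOp` replaces the two coefficients by their weighted
mean. -/
theorem symOp_pair {s : K →+* K} {G Γ : K} (hs : ∀ z, s (s z) = z) (hG : s G = 1 - G)
    (u : K →+* K) (hu : u Γ = G) (c d x : K) :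
    symOp s G (u (c * x) + s (u (d * x))) =
      u ((Γ * c + (1 - Γ) * d) * x) + s (u ((Γ * c + (1 - Γ) * d) * x)) := by
  simp only [symOp, map_mul, map_add, map_sub, map_one, hu, hs, hG]
  ring

/-- The case of `symOp_pair` in which the partner `s ∘ u` has not yet appeared, so its coefficient
is zero. -/
theorem symOp_single {s : K →+* K} {G Γ : K}
    (u : K →+* K) (hu : u Γ = G) (c x : K) :
    symOp s G (u (c * x)) = u (Γ * c * x) + s (u (Γ * c * x)) := by
  simp only [symOp, map_mul, hu]
  ring

variable {s t : K →+* K} {G₁ G₂ G₃ G₄ G₅ G₆ : K}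

theorem symOp_alternating_two (h₂ : s G₂ = G₂) (x : K) :
    symOp t G₂ (symOp s G₁ x) =
      G₂ * G₁ * x + t (G₂ * G₁ * x) + s (G₂ * G₁ * x) + t (s (G₂ * G₁ * x)) := by
  have e₁ := symOp_single (s := s) (RingHom.id K) (Γ := G₁) rfl 1 x
  have e₂ := symOp_single (s := t) (RingHom.id K) (Γ := G₂) rfl G₁ x
  have e₃ := symOp_single (s := t) s h₂ G₁ x
  simp only [RingHom.id_apply, one_mul, mul_one] at e₁ e₂
  rw [e₁, symOp_add, e₂, e₃]
  ring

/-- Here and below the coefficient of each dihedral word `u` is tracked through the successive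
operators. The hypotheses `h` supply the `Γ` with `u Γ = G` for each `u` met: unprimed for words
with `s` innermost, primed for `t` innermost. The relations `hrel` say that the remaining weighted
means equal the full product of the `G`'s. -/
theorem symOp_alternating_three (hs : ∀ z, s (s z) = z) (hG₁ : s G₁ = 1 - G₁)
    (h₂ : s G₂ = G₃) (h₃ : t (s G₃) = G₁) (h₂' : t G₂ = G₁)
    (hrel : G₁ * (G₃ * G₁) + (1 - G₁) * (G₂ * G₁) = G₁ * G₂ * G₃) (x : K) :
    symOp s G₁ (symOp t G₃ (symOp s G₁ x)) =
      G₁ * G₂ * G₃ * x + s (G₁ * G₂ * G₃ * x) + t (G₁ * G₂ * G₃ * x) +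
      s (t (G₁ * G₂ * G₃ * x)) + t (s (G₁ * G₂ * G₃ * x)) + s (t (s (G₁ * G₂ * G₃ * x))) := by
  have e₁ := symOp_single (s := s) (RingHom.id K) (Γ := G₁) rfl 1 x
  have e₂ := symOp_single (s := t) (RingHom.id K) (Γ := G₃) rfl G₁ x
  have e₃ := symOp_single (s := t) s h₂ G₁ x
  have e₄ := symOp_pair hs hG₁ (RingHom.id K) (Γ := G₁) rfl (G₃ * G₁) (G₂ * G₁) x
  have e₅ := symOp_single (s := s) t h₂' (G₃ * G₁) x
  have e₆ := symOp_single (s := s) (t.comp s) h₃ (G₂ * G₁) x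
  simp only [RingHom.id_apply, RingHom.comp_apply, one_mul, mul_one] at e₁ e₂ e₄ e₆
  rw [e₁, symOp_add t, e₂, e₃,
    -- Regrouping places the terms at `u` and `s ∘ u` side by side, as `symOp_pair` requires.
    show ∀ a b c d : K, a + b + (c + d) = a + c + b + d by intros; ring, symOp_add s, symOp_add s,
    e₄, e₅, e₆, hrel, show G₂ * (G₃ * G₁) = G₁ * G₂ * G₃ by ring,
    show G₃ * (G₂ * G₁) = G₁ * G₂ * G₃ by ring]
  ring

theorem symOp_alternating_four (hs : ∀ z, s (s z) = z) (ht : ∀ z, t (t z) = z)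
    (hG₁ : s G₁ = 1 - G₁) (hG₄ : t G₄ = 1 - G₄)
    (h₂ : s G₂ = G₄) (h₃ : t (s G₃) = G₁) (h₄ : s (t (s G₄)) = G₄)
    (h₂' : t G₃ = G₁) (h₃' : s (t G₂) = G₄)
    (hrel₁ : G₂ * (G₁ * (G₄ * G₁) + (1 - G₁) * (G₂ * G₁)) + (1 - G₂) * (G₃ * (G₂ * G₁)) =
      G₁ * G₂ * G₃ * G₄)
    (hrel₂ : G₄ * (G₁ * (G₄ * G₁) + (1 - G₁) * (G₂ * G₁)) + (1 - G₄) * (G₃ * (G₄ * G₁)) =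
      G₁ * G₂ * G₃ * G₄) (x : K) :
    symOp t G₄ (symOp s G₁ (symOp t G₄ (symOp s G₁ x))) =
      G₁ * G₂ * G₃ * G₄ * x + s (G₁ * G₂ * G₃ * G₄ * x) + t (G₁ * G₂ * G₃ * G₄ * x) +
      s (t (G₁ * G₂ * G₃ * G₄ * x)) + t (s (G₁ * G₂ * G₃ * G₄ * x)) +
      s (t (s (G₁ * G₂ * G₃ * G₄ * x))) + t (s (t (G₁ * G₂ * G₃ * G₄ * x))) +
      t (s (t (s (G₁ * G₂ * G₃ * G₄ * x)))) := by
  have e₁ := symOp_single (s := s) (RingHom.id K) (Γ := G₁) rfl 1 x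
  have e₂ := symOp_single (s := t) (RingHom.id K) (Γ := G₄) rfl G₁ x
  have e₃ := symOp_single (s := t) s h₂ G₁ x
  have e₄ := symOp_pair hs hG₁ (RingHom.id K) (Γ := G₁) rfl (G₄ * G₁) (G₂ * G₁) x
  have e₅ := symOp_single (s := s) t h₂' (G₄ * G₁) x
  have e₆ := symOp_single (s := s) (t.comp s) h₃ (G₂ * G₁) x
  simp only [RingHom.id_apply, RingHom.comp_apply, one_mul, mul_one] at e₁ e₂ e₄ e₆
  rw [e₁, symOp_add t, e₂, e₃,
    show ∀ a b c d : K, a + b + (c + d) = a + c + b + d by intros; ring, symOp_add s, symOp_add s,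
    e₄, e₅, e₆]
  set r₁ := G₁ * (G₄ * G₁) + (1 - G₁) * (G₂ * G₁)
  set r₂ := G₃ * (G₄ * G₁)
  set r₃ := G₃ * (G₂ * G₁)
  have f₁ := symOp_pair ht hG₄ (RingHom.id K) (Γ := G₄) rfl r₁ r₂ x
  have f₂ := symOp_pair ht hG₄ s h₂ r₁ r₃ x
  have f₃ := symOp_single (s := t) (s.comp t) h₃' r₂ x
  have f₄ := symOp_single (s := t) (s.comp (t.comp s)) h₄ r₃ x
  simp only [RingHom.id_apply, RingHom.comp_apply] at f₁ f₂ f₃ f₄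
  rw [show ∀ a b c d e f : K, a + b + (c + d) + (e + f) = a + c + (b + e) + d + f by
      intros; ring, symOp_add t, symOp_add t, symOp_add t, f₁, f₂, f₃, f₄, hrel₁, hrel₂,
    show G₂ * r₂ = G₁ * G₂ * G₃ * G₄ by simp only [r₂]; ring,
    show G₄ * r₃ = G₁ * G₂ * G₃ * G₄ by simp only [r₃]; ring]
  ring

/-- The `r`, `q`, `p` are the coefficients after three, four and five operators; each is shared by a
pair `u`, `s ∘ u` or `u`, `t ∘ u`. Naming them keeps the expressions small. -/
theorem symOp_alternating_six (hs : ∀ z, s (s z) = z) (ht : ∀ z, t (t z) = z)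
    (hG₁ : s G₁ = 1 - G₁) (hG₆ : t G₆ = 1 - G₆)
    (h₂ : s G₂ = G₆) (h₃ : t (s G₃) = G₁) (h₄ : s (t (s G₄)) = G₆)
    (h₅ : t (s (t (s G₅))) = G₁) (h₆ : s (t (s (t (s G₆)))) = G₆)
    (h₂' : t G₅ = G₁) (h₃' : s (t G₄) = G₆) (h₄' : t (s (t G₃)) = G₁)
    (h₅' : s (t (s (t G₂))) = G₆)
    {r₁ r₂ r₃ q₀ q₂ q₃ q₄ p₁ p₂ p₃ p₄ p₅ q : K}
    (hr₁ : r₁ = G₁ * (G₆ * G₁) + (1 - G₁) * (G₂ * G₁))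
    (hr₂ : r₂ = G₅ * (G₆ * G₁)) (hr₃ : r₃ = G₃ * (G₂ * G₁))
    (hq₀ : q₀ = G₆ * r₁ + (1 - G₆) * r₂) (hq₂ : q₂ = G₂ * r₁ + (1 - G₂) * r₃)
    (hq₃ : q₃ = G₄ * r₂) (hq₄ : q₄ = G₄ * r₃)
    (hp₁ : p₁ = G₁ * q₀ + (1 - G₁) * q₂) (hp₂ : p₂ = G₅ * q₀ + (1 - G₅) * q₃)
    (hp₃ : p₃ = G₃ * q₂ + (1 - G₃) * q₄) (hp₄ : p₄ = G₃ * q₃) (hp₅ : p₅ = G₅ * q₄)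
    (hq : q = G₁ * G₂ * G₃ * G₄ * G₅ * G₆)
    (hrel₁ : G₆ * p₁ + (1 - G₆) * p₂ = q) (hrel₂ : G₂ * p₁ + (1 - G₂) * p₃ = q)
    (hrel₃ : G₄ * p₂ + (1 - G₄) * p₄ = q) (hrel₄ : G₄ * p₃ + (1 - G₄) * p₅ = q) (x : K) :
    symOp t G₆ (symOp s G₁ (symOp t G₆ (symOp s G₁ (symOp t G₆ (symOp s G₁ x))))) =
      q * x + s (q * x) + t (q * x) + s (t (q * x)) + t (s (q * x)) +
      s (t (s (q * x))) + t (s (t (q * x))) + t (s (t (s (q * x)))) + s (t (s (t (q * x)))) +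
      s (t (s (t (s (q * x))))) + t (s (t (s (t (q * x))))) +
      t (s (t (s (t (s (q * x)))))) := by
  have e₁ := symOp_single (s := s) (RingHom.id K) (Γ := G₁) rfl 1 x
  have e₂ := symOp_single (s := t) (RingHom.id K) (Γ := G₆) rfl G₁ x
  have e₃ := symOp_single (s := t) s h₂ G₁ x
  have e₄ := symOp_pair hs hG₁ (RingHom.id K) (Γ := G₁) rfl (G₆ * G₁) (G₂ * G₁) x
  have e₅ := symOp_single (s := s) t h₂' (G₆ * G₁) x
  have e₆ := symOp_single (s := s) (t.comp s) h₃ (G₂ * G₁) x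
  have f₁ := symOp_pair ht hG₆ (RingHom.id K) (Γ := G₆) rfl r₁ r₂ x
  have f₂ := symOp_pair ht hG₆ s h₂ r₁ r₃ x
  have f₃ := symOp_single (s := t) (s.comp t) h₃' r₂ x
  have f₄ := symOp_single (s := t) (s.comp (t.comp s)) h₄ r₃ x
  have g₁ := symOp_pair hs hG₁ (RingHom.id K) (Γ := G₁) rfl q₀ q₂ x
  have g₂ := symOp_pair hs hG₁ t h₂' q₀ q₃ x
  have g₃ := symOp_pair hs hG₁ (t.comp s) h₃ q₂ q₄ x
  have g₄ := symOp_single (s := s) (t.comp (s.comp t)) h₄' q₃ x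
  have g₅ := symOp_single (s := s) (t.comp (s.comp (t.comp s))) h₅ q₄ x
  have k₁ := symOp_pair ht hG₆ (RingHom.id K) (Γ := G₆) rfl p₁ p₂ x
  have k₂ := symOp_pair ht hG₆ s h₂ p₁ p₃ x
  have k₃ := symOp_pair ht hG₆ (s.comp t) h₃' p₂ p₄ x
  have k₄ := symOp_pair ht hG₆ (s.comp (t.comp s)) h₄ p₃ p₅ x
  have k₅ := symOp_single (s := t) (s.comp (t.comp (s.comp t))) h₅' p₄ x
  have k₆ := symOp_single (s := t) (s.comp (t.comp (s.comp (t.comp s)))) h₆ p₅ x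
  simp only [RingHom.id_apply, RingHom.comp_apply, one_mul, mul_one] at e₁ e₂ e₄ e₆
  simp only [RingHom.id_apply, RingHom.comp_apply] at f₁ f₂ f₃ f₄ g₁ g₂ g₃ g₄ g₅ k₁ k₂ k₃ k₄ k₅ k₆
  rw [← hr₁] at e₄
  rw [← hr₂] at e₅
  rw [← hr₃] at e₆
  rw [← hq₀] at f₁
  rw [← hq₂] at f₂
  rw [← hq₃] at f₃
  rw [← hq₄] at f₄
  rw [← hp₁] at g₁
  rw [← hp₂] at g₂
  rw [← hp₃] at g₃
  rw [← hp₄] at g₄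
  rw [← hp₅] at g₅
  rw [hrel₁] at k₁
  rw [hrel₂] at k₂
  rw [hrel₃] at k₃
  rw [hrel₄] at k₄
  rw [show G₂ * p₄ = q by subst_vars; ring] at k₅
  rw [show G₆ * p₅ = q by subst_vars; ring] at k₆
  rw [e₁, symOp_add t, e₂, e₃,
    show ∀ a b c d : K, a + b + (c + d) = a + c + b + d by intros; ring, symOp_add s, symOp_add s,
    e₄, e₅, e₆,
    show ∀ a b c d e f : K, a + b + (c + d) + (e + f) = a + c + (b + e) + d + f by
      intros; ring, symOp_add t, symOp_add t, symOp_add t, f₁, f₂, f₃, f₄,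
    show ∀ a b c d e f g h : K, a + b + (c + d) + (e + f) + (g + h) =
      a + c + (b + e) + (d + g) + f + h by intros; ring,
    symOp_add s, symOp_add s, symOp_add s, symOp_add s, g₁, g₂, g₃, g₄, g₅,
    show ∀ a b c d e f g h i j : K, a + b + (c + d) + (e + f) + (g + h) + (i + j) =
      a + c + (b + e) + (d + g) + (f + i) + h + j by intros; ring,
    symOp_add t, symOp_add t, symOp_add t, symOp_add t, symOp_add t, k₁, k₂, k₃, k₄, k₅, k₆]
  ring

end RankTwo

/-! ### Braid relations in a field, for types B₂, G₂, A₂ and A₁ × A₁ -/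

section Braid

variable {K : Type*} [Field K] {s t : K →+* K} {a b : K}

theorem map_inv_one_sub_eq (s : K →+* K) {e e' : K} (h : s e = e') :
    s (1 - e)⁻¹ = (1 - e')⁻¹ := by
  rw [map_inv₀, map_sub, map_one, h]

theorem inv_one_sub_inv {e : K} (he : e ≠ 0) (h : 1 - e ≠ 0) :
    (1 - e⁻¹)⁻¹ = 1 - (1 - e)⁻¹ := by
  have h' : e - 1 ≠ 0 := by rw [← neg_sub]; exact neg_ne_zero.mpr h
  have h'' : 1 - e⁻¹ = (e - 1) / e := by field_simp
  rw [h'']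
  field_simp
  ring

/-- For `a = e^{-α}`, `b = e^{-β}`, the monomials `a`, `a²b`, `ab`, `b` are the `e^{-γ}` for the
positive roots of B₂, in the order of a reduced word of the longest element. Exchanging `s` and `t`
reverses this order, so both expansions have the same coefficient, and `hst` identifies the two
words for the longest element. -/
theorem symOp_braid_four (hs : ∀ z, s (s z) = z) (ht : ∀ z, t (t z) = z)
    (hst : ∀ z, s (t (s (t z))) = t (s (t (s z))))
    (ha : a ≠ 0) (hb : b ≠ 0) (hsa : s a = a⁻¹) (htb : t b = b⁻¹)
    (hsb : s b = b * a ^ 2) (hta : t a = a * b)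
    (n₁ : 1 - a ≠ 0) (n₂ : 1 - a ^ 2 * b ≠ 0) (n₃ : 1 - a * b ≠ 0) (n₄ : 1 - b ≠ 0) (x : K) :
    symOp t (1 - b)⁻¹ (symOp s (1 - a)⁻¹ (symOp t (1 - b)⁻¹ (symOp s (1 - a)⁻¹ x))) =
    symOp s (1 - a)⁻¹ (symOp t (1 - b)⁻¹ (symOp s (1 - a)⁻¹ (symOp t (1 - b)⁻¹ x))) := by
  have m₂ : 1 - b * a ^ 2 ≠ 0 := by rwa [mul_comm]
  have m₃ : 1 - b * a ≠ 0 := by rwa [mul_comm]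
  have hGs : s (1 - a)⁻¹ = 1 - (1 - a)⁻¹ := by
    rw [map_inv_one_sub_eq s hsa, inv_one_sub_inv ha n₁]
  have hGt : t (1 - b)⁻¹ = 1 - (1 - b)⁻¹ := by
    rw [map_inv_one_sub_eq t htb, inv_one_sub_inv hb n₄]
  have s₂ : s (1 - a ^ 2 * b)⁻¹ = (1 - b)⁻¹ :=
    map_inv_one_sub_eq s (by simp only [map_mul, map_pow, hsa, hsb]; field_simp)
  have s₃ : s (1 - a * b)⁻¹ = (1 - a * b)⁻¹ :=
    map_inv_one_sub_eq s (by simp only [map_mul, hsa, hsb]; field_simp)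
  have s₄ : s (1 - b)⁻¹ = (1 - a ^ 2 * b)⁻¹ := by rw [← s₂, hs]
  have t₂ : t (1 - a ^ 2 * b)⁻¹ = (1 - a ^ 2 * b)⁻¹ :=
    map_inv_one_sub_eq t (by simp only [map_mul, map_pow, hta, htb]; field_simp)
  have t₃ : t (1 - a * b)⁻¹ = (1 - a)⁻¹ :=
    map_inv_one_sub_eq t (by simp only [map_mul, hta, htb]; field_simp)
  have t₁ : t (1 - a)⁻¹ = (1 - a * b)⁻¹ := by rw [← t₃, ht]
  rw [symOp_alternating_four (G₁ := (1 - a)⁻¹) (G₂ := (1 - a ^ 2 * b)⁻¹) (G₃ := (1 - a * b)⁻¹)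
      (G₄ := (1 - b)⁻¹) hs ht hGs hGt s₂ (by rw [s₃, t₃]) (by rw [s₄, t₂, s₂]) t₃ (by rw [t₂, s₂])
      (by field_simp; ring) (by field_simp; ring),
    symOp_alternating_four (G₁ := (1 - b)⁻¹) (G₂ := (1 - a * b)⁻¹) (G₃ := (1 - a ^ 2 * b)⁻¹)
      (G₄ := (1 - a)⁻¹) ht hs hGt hGs t₃ (by rw [t₂, s₂]) (by rw [t₁, s₃, t₃]) s₂ (by rw [s₃, t₃])
      (by field_simp; ring) (by field_simp; ring), hst]
  ring_nf

theorem symOp_braid_six (hs : ∀ z, s (s z) = z) (ht : ∀ z, t (t z) = z)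
    (hst : ∀ z, s (t (s (t (s (t z))))) = t (s (t (s (t (s z))))))
    (ha : a ≠ 0) (hb : b ≠ 0) (hsa : s a = a⁻¹) (htb : t b = b⁻¹)
    (hsb : s b = b * a ^ 3) (hta : t a = a * b)
    (n₁ : 1 - a ≠ 0) (n₂ : 1 - a ^ 3 * b ≠ 0) (n₃ : 1 - a ^ 2 * b ≠ 0)
    (n₄ : 1 - a ^ 3 * b ^ 2 ≠ 0) (n₅ : 1 - a * b ≠ 0) (n₆ : 1 - b ≠ 0) (x : K) :
    symOp t (1 - b)⁻¹ (symOp s (1 - a)⁻¹ (symOp t (1 - b)⁻¹ (symOp s (1 - a)⁻¹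
      (symOp t (1 - b)⁻¹ (symOp s (1 - a)⁻¹ x))))) =
    symOp s (1 - a)⁻¹ (symOp t (1 - b)⁻¹ (symOp s (1 - a)⁻¹ (symOp t (1 - b)⁻¹
      (symOp s (1 - a)⁻¹ (symOp t (1 - b)⁻¹ x))))) := by
  have m₂ : 1 - b * a ^ 3 ≠ 0 := by rwa [mul_comm]
  have m₃ : 1 - b * a ^ 2 ≠ 0 := by rwa [mul_comm]
  have m₄ : 1 - b ^ 2 * a ^ 3 ≠ 0 := by rwa [mul_comm]
  have m₅ : 1 - b * a ≠ 0 := by rwa [mul_comm]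
  have hGs : s (1 - a)⁻¹ = 1 - (1 - a)⁻¹ := by
    rw [map_inv_one_sub_eq s hsa, inv_one_sub_inv ha n₁]
  have hGt : t (1 - b)⁻¹ = 1 - (1 - b)⁻¹ := by
    rw [map_inv_one_sub_eq t htb, inv_one_sub_inv hb n₆]
  have s₂ : s (1 - a ^ 3 * b)⁻¹ = (1 - b)⁻¹ :=
    map_inv_one_sub_eq s (by simp only [map_mul, map_pow, hsa, hsb]; field_simp)
  have s₃ : s (1 - a ^ 2 * b)⁻¹ = (1 - a * b)⁻¹ :=
    map_inv_one_sub_eq s (by simp only [map_mul, map_pow, hsa, hsb]; field_simp)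
  have s₄ : s (1 - a ^ 3 * b ^ 2)⁻¹ = (1 - a ^ 3 * b ^ 2)⁻¹ :=
    map_inv_one_sub_eq s (by simp only [map_mul, map_pow, hsa, hsb]; field_simp)
  have s₅ : s (1 - a * b)⁻¹ = (1 - a ^ 2 * b)⁻¹ := by rw [← s₃, hs]
  have s₆ : s (1 - b)⁻¹ = (1 - a ^ 3 * b)⁻¹ := by rw [← s₂, hs]
  have t₂ : t (1 - a ^ 3 * b)⁻¹ = (1 - a ^ 3 * b ^ 2)⁻¹ :=
    map_inv_one_sub_eq t (by simp only [map_mul, map_pow, hta, htb]; field_simp)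
  have t₃ : t (1 - a ^ 2 * b)⁻¹ = (1 - a ^ 2 * b)⁻¹ :=
    map_inv_one_sub_eq t (by simp only [map_mul, map_pow, hta, htb]; field_simp)
  have t₄ : t (1 - a ^ 3 * b ^ 2)⁻¹ = (1 - a ^ 3 * b)⁻¹ := by rw [← t₂, ht]
  have t₅ : t (1 - a * b)⁻¹ = (1 - a)⁻¹ :=
    map_inv_one_sub_eq t (by simp only [map_mul, hta, htb]; field_simp)
  have t₁ : t (1 - a)⁻¹ = (1 - a * b)⁻¹ := by rw [← t₅, ht]
  rw [symOp_alternating_six (G₁ := (1 - a)⁻¹) (G₂ := (1 - a ^ 3 * b)⁻¹)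
      (G₃ := (1 - a ^ 2 * b)⁻¹) (G₄ := (1 - a ^ 3 * b ^ 2)⁻¹) (G₅ := (1 - a * b)⁻¹)
      (G₆ := (1 - b)⁻¹) hs ht hGs hGt s₂ (by rw [s₃, t₅]) (by rw [s₄, t₄, s₂])
      (by rw [s₅, t₃, s₃, t₅]) (by rw [s₆, t₂, s₄, t₄, s₂]) t₅ (by rw [t₄, s₂])
      (by rw [t₃, s₃, t₅]) (by rw [t₂, s₄, t₄, s₂]) rfl rfl rfl rfl rfl rfl rfl rfl rfl rfl rfl
      rfl rfl (by field_simp; ring) (by field_simp; ring) (by field_simp; ring)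
      (by field_simp; ring),
    symOp_alternating_six (G₁ := (1 - b)⁻¹) (G₂ := (1 - a * b)⁻¹)
      (G₃ := (1 - a ^ 3 * b ^ 2)⁻¹) (G₄ := (1 - a ^ 2 * b)⁻¹) (G₅ := (1 - a ^ 3 * b)⁻¹)
      (G₆ := (1 - a)⁻¹) ht hs hGt hGs t₅ (by rw [t₄, s₂]) (by rw [t₃, s₃, t₅])
      (by rw [t₂, s₄, t₄, s₂]) (by rw [t₁, s₅, t₃, s₃, t₅]) s₂ (by rw [s₃, t₅])
      (by rw [s₄, t₄, s₂]) (by rw [s₅, t₃, s₃, t₅]) rfl rfl rfl rfl rfl rfl rfl rfl rfl rfl rfl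
      rfl rfl (by field_simp; ring) (by field_simp; ring) (by field_simp; ring)
      (by field_simp; ring), hst]
  ring_nf

theorem symOp_braid_three (hs : ∀ z, s (s z) = z) (ht : ∀ z, t (t z) = z)
    (hst : ∀ z, s (t (s z)) = t (s (t z)))
    (ha : a ≠ 0) (hb : b ≠ 0) (hsa : s a = a⁻¹) (htb : t b = b⁻¹)
    (hsb : s b = b * a) (hta : t a = a * b)
    (n₁ : 1 - a ≠ 0) (n₂ : 1 - a * b ≠ 0) (n₃ : 1 - b ≠ 0) (x : K) :
    symOp s (1 - a)⁻¹ (symOp t (1 - b)⁻¹ (symOp s (1 - a)⁻¹ x)) =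
    symOp t (1 - b)⁻¹ (symOp s (1 - a)⁻¹ (symOp t (1 - b)⁻¹ x)) := by
  have m₂ : 1 - b * a ≠ 0 := by rwa [mul_comm]
  have hGs : s (1 - a)⁻¹ = 1 - (1 - a)⁻¹ := by
    rw [map_inv_one_sub_eq s hsa, inv_one_sub_inv ha n₁]
  have hGt : t (1 - b)⁻¹ = 1 - (1 - b)⁻¹ := by
    rw [map_inv_one_sub_eq t htb, inv_one_sub_inv hb n₃]
  have s₂ : s (1 - a * b)⁻¹ = (1 - b)⁻¹ :=
    map_inv_one_sub_eq s (by simp only [map_mul, hsa, hsb]; field_simp)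
  have s₃ : s (1 - b)⁻¹ = (1 - a * b)⁻¹ := by rw [← s₂, hs]
  have t₂ : t (1 - a * b)⁻¹ = (1 - a)⁻¹ :=
    map_inv_one_sub_eq t (by simp only [map_mul, hta, htb]; field_simp)
  have t₁ : t (1 - a)⁻¹ = (1 - a * b)⁻¹ := by rw [← t₂, ht]
  rw [symOp_alternating_three (G₁ := (1 - a)⁻¹) (G₂ := (1 - a * b)⁻¹) (G₃ := (1 - b)⁻¹)
      hs hGs s₂ (by rw [s₃, t₂]) t₂ (by field_simp; ring),
    symOp_alternating_three (G₁ := (1 - b)⁻¹) (G₂ := (1 - a * b)⁻¹) (G₃ := (1 - a)⁻¹)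
      ht hGt t₂ (by rw [t₁, s₂]) s₂ (by field_simp; ring), hst]
  ring_nf

theorem symOp_braid_two (hst : ∀ z, s (t z) = t (s z)) (hsb : s b = b) (hta : t a = a) (x : K) :
    symOp t (1 - b)⁻¹ (symOp s (1 - a)⁻¹ x) = symOp s (1 - a)⁻¹ (symOp t (1 - b)⁻¹ x) := by
  rw [symOp_alternating_two (map_inv_one_sub_eq s hsb),
    symOp_alternating_two (map_inv_one_sub_eq t hta), hst]
  ring_nf

end Braid

/-! ### The operators `δ_a` on the fraction field of `ℤ[X]` -/

section FractionField

variable {ι X Y : Type*} [AddCommGroup X] [AddCommGroup Y]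

instance isDomain_charRing [Module.Free ℤ X] : IsDomain (CharRing X) :=
  have : NoZeroDivisors (CharRing X) := noZeroDivisors
  NoZeroDivisors.to_isDomain _

theorem ex_nsmul (n : ℕ) (l : X) : ex (n • l) = ex l ^ n := by
  induction n with
  | zero => simp [ex_zero]
  | succ n ih => rw [succ_nsmul, ex_add, ih, pow_succ]

variable (P : RootDatum ι X Y)

theorem weylAct_injective (w : P.weylGroup) : Function.Injective (weylAct P w) := by
  have h (u : CharRing X) : weylAct P w⁻¹ (weylAct P w u) = u := by
    rw [← AlgHom.mul_apply, ← map_mul, inv_mul_cancel, map_one, AlgHom.one_apply]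
  exact Function.LeftInverse.injective h

/-- The element `e^{-a}` of the fraction field for the `i`-th root `a`. -/
def fracRoot (i : ι) : FractionRing (CharRing X) := algebraMap (CharRing X) _ (ex (-P.root i))

theorem fracRoot_ne_zero (i : ι) : fracRoot P i ≠ 0 := by
  intro h
  have h' : fracRoot P i * algebraMap (CharRing X) _ (ex (P.root i)) = 1 := by
    rw [fracRoot, ← map_mul, ← ex_add, neg_add_cancel, ex_zero, map_one]
  rw [h, zero_mul] at h'
  exact zero_ne_one h'

theorem one_sub_algebraMap_ex_ne_zero {l : X} (hl : l ≠ 0) :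
    1 - algebraMap (CharRing X) (FractionRing (CharRing X)) (ex l) ≠ 0 := by
  rw [← map_one (algebraMap (CharRing X) (FractionRing (CharRing X))), ← map_sub]
  exact (map_ne_zero_iff _ (IsFractionRing.injective _ _)).mpr (one_sub_ex_ne_zero hl)

theorem one_sub_fracRoot_ne_zero (i : ι) : 1 - fracRoot P i ≠ 0 :=
  one_sub_algebraMap_ex_ne_zero (neg_ne_zero.mpr (P.ne_zero i))

variable [Module.Free ℤ X]

/-- The action of the Weyl group on the fraction field of `ℤ[X]`. -/
def fracAct (w : P.weylGroup) : FractionRing (CharRing X) →+* FractionRing (CharRing X) :=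
  IsLocalization.map (T := nonZeroDivisors (CharRing X)) (FractionRing (CharRing X))
    (weylAct P w : CharRing X →+* CharRing X)
    (nonZeroDivisors_le_comap_nonZeroDivisors_of_injective _ (weylAct_injective P w))

theorem fracAct_algebraMap (w : P.weylGroup) (u : CharRing X) :
    fracAct P w (algebraMap _ _ u) = algebraMap _ _ (weylAct P w u) :=
  IsLocalization.map_eq _ _

theorem fracAct_mul (v w : P.weylGroup) (z : FractionRing (CharRing X)) :
    fracAct P (v * w) z = fracAct P v (fracAct P w z) := by
  have h : fracAct P (v * w) = (fracAct P v).comp (fracAct P w) := by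
    apply IsLocalization.ringHom_ext (nonZeroDivisors (CharRing X))
    refine RingHom.ext fun u => ?_
    simp only [RingHom.comp_apply, fracAct_algebraMap, map_mul, AlgHom.mul_apply]
  rw [h, RingHom.comp_apply]

theorem fracAct_refl_refl (i : ι) (z : FractionRing (CharRing X)) :
    fracAct P (refl P i) (fracAct P (refl P i) z) = z := by
  have h : (fracAct P (refl P i)).comp (fracAct P (refl P i)) = RingHom.id _ := by
    apply IsLocalization.ringHom_ext (nonZeroDivisors (CharRing X))
    refine RingHom.ext fun u => ?_
    simp only [RingHom.comp_apply, fracAct_algebraMap, ← AlgHom.mul_apply, ← map_mul,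
      refl_mul_self, map_one, AlgHom.one_apply, RingHom.id_apply]
  exact RingHom.congr_fun h z

theorem fracAct_fracRoot_self (i : ι) :
    fracAct P (refl P i) (fracRoot P i) = (fracRoot P i)⁻¹ := by
  apply eq_inv_of_mul_eq_one_left
  rw [fracRoot, fracAct_algebraMap, weylAct_ex,
    ← map_mul, ← ex_add, smul_neg, refl_smul_root, P.pairing_same]
  have : -(P.root i - (2 : ℤ) • P.root i) + -P.root i = 0 := by module
  rw [this, ex_zero, map_one]

theorem fracAct_fracRoot {i j : ι} {n : ℕ} (h : P.pairing j i = -n) :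
    fracAct P (refl P i) (fracRoot P j) = fracRoot P j * fracRoot P i ^ n := by
  rw [fracRoot, fracRoot, fracAct_algebraMap, weylAct_ex, ← map_pow, ← ex_nsmul, ← map_mul,
    ← ex_add, smul_neg, refl_smul_root, h]
  congr 2
  module

theorem algebraMap_divDiff (i : ι) (u : CharRing X) :
    algebraMap (CharRing X) (FractionRing (CharRing X)) (divDiff P i u) =
      symOp (fracAct P (refl P i)) (1 - fracRoot P i)⁻¹ (algebraMap _ _ u) := by
  have h := congrArg (algebraMap (CharRing X) (FractionRing (CharRing X))) (denom_mul_divDiff P i u)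
  rw [map_mul, map_sub, map_sub, map_mul, map_one, ← fracAct_algebraMap, ← fracRoot] at h
  have hne := one_sub_fracRoot_ne_zero P i
  -- Since `s_a(G) = 1 - G = -e^{-a} G`, the symmetrised form `G x + s_a(G x)` is the divided
  -- difference.
  have hG : fracAct P (refl P i) (1 - fracRoot P i)⁻¹ = 1 - (1 - fracRoot P i)⁻¹ := by
    rw [map_inv_one_sub_eq _ (fracAct_fracRoot_self P i),
      inv_one_sub_inv (fracRoot_ne_zero P i) hne]
  rw [symOp, map_mul, hG]
  apply mul_left_cancel₀ hne
  rw [h]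
  field_simp
  ring

end FractionField

/-! ### Pairs of simple roots and braid pairs of words -/

section SimplePairs

variable {ι X Y : Type*} [AddCommGroup X] [AddCommGroup Y] {P : RootDatum ι X Y} (b : P.Base)

theorem nsmul_add_nsmul_ne_zero {i j : b.support} (hij : i ≠ j) {x y : ℕ} (h : x ≠ 0 ∨ y ≠ 0) :
    x • P.root i + y • P.root j ≠ 0 := by
  intro h0
  have := LinearIndependent.pair_iff.mp (b.linearIndependent_pair_of_ne hij) x y
    (by simpa using h0)
  omega

theorem one_sub_fracRoot_pow_ne_zero [Module.Free ℤ X] {i j : b.support} (hij : i ≠ j) {x y : ℕ}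
    (h : x ≠ 0 ∨ y ≠ 0) : 1 - fracRoot P i ^ x * fracRoot P j ^ y ≠ 0 := by
  rw [fracRoot, fracRoot, ← map_pow, ← map_pow, ← ex_nsmul, ← ex_nsmul, ← map_mul, ← ex_add]
  apply one_sub_algebraMap_ex_ne_zero
  have := nsmul_add_nsmul_ne_zero b hij h
  rwa [smul_neg, smul_neg, ← neg_add, neg_ne_zero]

theorem demazure_cons [Module.Free ℤ X] (i : b.support) (l : List b.support) :
    demazure b (i :: l) = divDiffD P i * demazure b l := by
  simp [demazure]

theorem demazure_append [Module.Free ℤ X] (l m : List b.support) :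
    demazure b (l ++ m) = demazure b l * demazure b m := by
  simp [demazure]

theorem demazure_cons_apply [Module.Free ℤ X] (i : b.support) (l : List b.support)
    (u : CharRing X) : (demazure b (i :: l) : EndRing P) u =
      divDiff P i ((demazure b l : EndRing P) u) := by
  rw [demazure_cons]
  rfl

/-- Two words, beginning with the simple roots `i` and `j`, satisfy the braid relation both in the
Weyl group and for the operators `δ`, and their roots are nonnegative combinations. -/
structure IsBraid [Module.Free ℤ X] (i j : b.support) (c c' : List b.support) : Prop where
  wordProd_eq : wordProd b (i :: c) = wordProd b (j :: c')
  demazure_eq : demazure b (i :: c) = demazure b (j :: c')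
  length_eq : c.length = c'.length
  inversions_left : InversionsNonneg b i j 1 (i :: c)
  inversions_right : InversionsNonneg b i j 1 (j :: c')

theorem InversionsNonneg.swap {i j : ι} {g : P.weylGroup} {c : List b.support}
    (h : InversionsNonneg b i j g c) : InversionsNonneg b j i g c := by
  induction c generalizing g with
  | nil => trivial
  | cons k l ih =>
    obtain ⟨⟨x, y, h⟩, hl⟩ := h
    exact ⟨⟨y, x, by rw [h, add_comm]⟩, ih hl⟩

theorem IsBraid.symm [Module.Free ℤ X] {i j : b.support} {c c' : List b.support}
    (h : IsBraid b i j c c') : IsBraid b j i c' c :=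
  ⟨h.wordProd_eq.symm, h.demazure_eq.symm, h.length_eq.symm, h.inversions_right.swap,
    h.inversions_left.swap⟩

theorem demazure_ext [Module.Free ℤ X] {c c' : List b.support}
    (h : ∀ u, algebraMap (CharRing X) (FractionRing (CharRing X)) ((demazure b c : EndRing P) u) =
      algebraMap _ _ ((demazure b c' : EndRing P) u)) : demazure b c = demazure b c' :=
  Subtype.ext (LinearMap.ext fun u => IsFractionRing.injective _ _ (h u))

end SimplePairs

/-! ### Braid relations for two simple roots, by Cartan integers -/

section BraidRelations

variable {ι X Y : Type*} [AddCommGroup X] [AddCommGroup Y] {P : RootDatum ι X Y}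

theorem weyl_smul_nsmul (w : P.weylGroup) (n : ℕ) (x : X) : w • n • x = n • w • x :=
  smul_comm w n x

theorem weyl_smul_zsmul (w : P.weylGroup) (n : ℤ) (x : X) : w • n • x = n • w • x :=
  smul_comm w n x

theorem refl_smul_root_self (i : ι) : refl P i • P.root i = -P.root i := by
  rw [refl_smul_root, P.pairing_same]
  module

theorem refl_smul_root_of_pairing_eq {i j : ι} {n : ℕ} (h : P.pairing j i = -n) :
    refl P i • P.root j = P.root j + n • P.root i := by
  rw [refl_smul_root, h]
  module

variable {b : P.Base}

theorem isBraid_two [Module.Free ℤ X] {i j : b.support}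
    (hji : P.pairing j i = -(0 : ℕ)) (hij : P.pairing i j = -(0 : ℕ)) :
    IsBraid b i j [j] [i] := by
  have rij := refl_smul_root_of_pairing_eq hji
  have rji := refl_smul_root_of_pairing_eq hij
  have hw : wordProd b (i :: [j]) = wordProd b (j :: [i]) := by
    -- The action on `X` is faithful; on a general `x` both words give `x` plus a combination of
    -- `α_i` and `α_j` with coefficients linear in the two coroot pairings of `x`.
    refine weyl_ext fun x => ?_
    have hi := refl_smul (P := P) i x
    have hj := refl_smul (P := P) j x
    simp only [wordProd_cons, wordProd_nil, mul_one, mul_smul, hi, hj, smul_sub,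
      weyl_smul_zsmul, rij, rji]
    module
  refine ⟨hw, demazure_ext b fun u => ?_, rfl, ?_, ?_⟩
  · simp only [demazure_cons_apply, algebraMap_divDiff]
    have hst (z) := congrArg (fun w => fracAct P w z) hw
    simp only [wordProd_cons, wordProd_nil, mul_one, fracAct_mul] at hst
    exact (symOp_braid_two hst (by simpa using fracAct_fracRoot P hji)
      (by simpa using fracAct_fracRoot P hij) _).symm
  · refine ⟨⟨1, 0, ?_⟩, ⟨0, 1, ?_⟩, trivial⟩ <;>
    simp only [one_mul, one_smul, rij] <;> module
  · refine ⟨⟨0, 1, ?_⟩, ⟨1, 0, ?_⟩, trivial⟩ <;>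
    simp only [one_mul, one_smul, rji] <;> module

theorem isBraid_three [Module.Free ℤ X] {i j : b.support} (hne : i ≠ j)
    (hji : P.pairing j i = -(1 : ℕ)) (hij : P.pairing i j = -(1 : ℕ)) :
    IsBraid b i j [j, i] [i, j] := by
  have rii := refl_smul_root_self (P := P) i
  have rjj := refl_smul_root_self (P := P) j
  have rij := refl_smul_root_of_pairing_eq hji
  have rji := refl_smul_root_of_pairing_eq hij
  have hw : wordProd b (i :: [j, i]) = wordProd b (j :: [i, j]) := by
    refine weyl_ext fun x => ?_
    have hi := refl_smul (P := P) i x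
    have hj := refl_smul (P := P) j x
    simp only [wordProd_cons, wordProd_nil, mul_one, mul_smul, hi, hj, smul_sub, smul_add,
      smul_neg, weyl_smul_zsmul, weyl_smul_nsmul, rii, rjj, rij, rji]
    module
  refine ⟨hw, demazure_ext b fun u => ?_, rfl, ?_, ?_⟩
  · simp only [demazure_cons_apply, algebraMap_divDiff]
    have hst (z) := congrArg (fun w => fracAct P w z) hw
    simp only [wordProd_cons, wordProd_nil, mul_one, fracAct_mul] at hst
    exact symOp_braid_three (fracAct_refl_refl P i) (fracAct_refl_refl P j) hst
      (fracRoot_ne_zero P i) (fracRoot_ne_zero P j) (fracAct_fracRoot_self P i)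
      (fracAct_fracRoot_self P j) (by simpa using fracAct_fracRoot P hji)
      (by simpa using fracAct_fracRoot P hij)
      (by simpa using one_sub_fracRoot_pow_ne_zero b hne (x := 1) (y := 0) (by simp))
      (by simpa using one_sub_fracRoot_pow_ne_zero b hne (x := 1) (y := 1) (by simp))
      (by simpa using one_sub_fracRoot_pow_ne_zero b hne (x := 0) (y := 1) (by simp)) _
  · refine ⟨⟨1, 0, ?_⟩, ⟨1, 1, ?_⟩, ⟨0, 1, ?_⟩, trivial⟩ <;>
    simp only [one_mul, one_smul, mul_smul, smul_add, rii, rij, rji] <;> module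
  · refine ⟨⟨0, 1, ?_⟩, ⟨1, 1, ?_⟩, ⟨1, 0, ?_⟩, trivial⟩ <;>
    simp only [one_mul, one_smul, mul_smul, smul_add, rjj, rij, rji] <;> module

theorem isBraid_four [Module.Free ℤ X] {i j : b.support} (hne : i ≠ j)
    (hji : P.pairing j i = -(2 : ℕ)) (hij : P.pairing i j = -(1 : ℕ)) :
    IsBraid b i j [j, i, j] [i, j, i] := by
  have rii := refl_smul_root_self (P := P) i
  have rjj := refl_smul_root_self (P := P) j
  have rij := refl_smul_root_of_pairing_eq hji
  have rji := refl_smul_root_of_pairing_eq hij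
  have hw : wordProd b (i :: [j, i, j]) = wordProd b (j :: [i, j, i]) := by
    refine weyl_ext fun x => ?_
    have hi := refl_smul (P := P) i x
    have hj := refl_smul (P := P) j x
    simp only [wordProd_cons, wordProd_nil, mul_one, mul_smul, hi, hj, smul_sub, smul_add,
      smul_neg, weyl_smul_zsmul, weyl_smul_nsmul, rii, rjj, rij, rji]
    module
  refine ⟨hw, demazure_ext b fun u => ?_, rfl, ?_, ?_⟩
  · simp only [demazure_cons_apply, algebraMap_divDiff]
    have hst (z) := congrArg (fun w => fracAct P w z) hw
    simp only [wordProd_cons, wordProd_nil, mul_one, fracAct_mul] at hst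
    exact (symOp_braid_four (fracAct_refl_refl P i) (fracAct_refl_refl P j) hst
      (fracRoot_ne_zero P i) (fracRoot_ne_zero P j) (fracAct_fracRoot_self P i)
      (fracAct_fracRoot_self P j) (by simpa using fracAct_fracRoot P hji)
      (by simpa using fracAct_fracRoot P hij)
      (by simpa using one_sub_fracRoot_pow_ne_zero b hne (x := 1) (y := 0) (by simp))
      (by simpa using one_sub_fracRoot_pow_ne_zero b hne (x := 2) (y := 1) (by simp))
      (by simpa using one_sub_fracRoot_pow_ne_zero b hne (x := 1) (y := 1) (by simp))
      (by simpa using one_sub_fracRoot_pow_ne_zero b hne (x := 0) (y := 1) (by simp)) _).symm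
  · refine ⟨⟨1, 0, ?_⟩, ⟨2, 1, ?_⟩, ⟨1, 1, ?_⟩, ⟨0, 1, ?_⟩, trivial⟩ <;>
    simp only [one_mul, one_smul, mul_smul, smul_add, smul_neg, weyl_smul_nsmul,
      rii, rjj, rij, rji] <;> module
  · refine ⟨⟨0, 1, ?_⟩, ⟨1, 1, ?_⟩, ⟨2, 1, ?_⟩, ⟨1, 0, ?_⟩, trivial⟩ <;>
    simp only [one_mul, one_smul, mul_smul, smul_add, smul_neg, weyl_smul_nsmul,
      rii, rjj, rij, rji] <;> module

theorem isBraid_six [Module.Free ℤ X] {i j : b.support} (hne : i ≠ j)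
    (hji : P.pairing j i = -(3 : ℕ)) (hij : P.pairing i j = -(1 : ℕ)) :
    IsBraid b i j [j, i, j, i, j] [i, j, i, j, i] := by
  have rii := refl_smul_root_self (P := P) i
  have rjj := refl_smul_root_self (P := P) j
  have rij := refl_smul_root_of_pairing_eq hji
  have rji := refl_smul_root_of_pairing_eq hij
  have hw : wordProd b (i :: [j, i, j, i, j]) = wordProd b (j :: [i, j, i, j, i]) := by
    refine weyl_ext fun x => ?_
    have hi := refl_smul (P := P) i x
    have hj := refl_smul (P := P) j x
    simp only [wordProd_cons, wordProd_nil, mul_one, mul_smul, hi, hj, smul_sub, smul_add,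
      smul_neg, weyl_smul_zsmul, weyl_smul_nsmul, rii, rjj, rij, rji]
    module
  refine ⟨hw, demazure_ext b fun u => ?_, rfl, ?_, ?_⟩
  · simp only [demazure_cons_apply, algebraMap_divDiff]
    have hst (z) := congrArg (fun w => fracAct P w z) hw
    simp only [wordProd_cons, wordProd_nil, mul_one, fracAct_mul] at hst
    exact (symOp_braid_six (fracAct_refl_refl P i) (fracAct_refl_refl P j) hst
      (fracRoot_ne_zero P i) (fracRoot_ne_zero P j) (fracAct_fracRoot_self P i)
      (fracAct_fracRoot_self P j) (by simpa using fracAct_fracRoot P hji)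
      (by simpa using fracAct_fracRoot P hij)
      (by simpa using one_sub_fracRoot_pow_ne_zero b hne (x := 1) (y := 0) (by simp))
      (by simpa using one_sub_fracRoot_pow_ne_zero b hne (x := 3) (y := 1) (by simp))
      (by simpa using one_sub_fracRoot_pow_ne_zero b hne (x := 2) (y := 1) (by simp))
      (by simpa using one_sub_fracRoot_pow_ne_zero b hne (x := 3) (y := 2) (by simp))
      (by simpa using one_sub_fracRoot_pow_ne_zero b hne (x := 1) (y := 1) (by simp))
      (by simpa using one_sub_fracRoot_pow_ne_zero b hne (x := 0) (y := 1) (by simp)) _).symm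
  -- The witnesses are the coordinates of the six positive roots of G₂, matching the exponents in
  -- `symOp_braid_six`.
  · refine ⟨⟨1, 0, ?_⟩, ⟨3, 1, ?_⟩, ⟨2, 1, ?_⟩, ⟨3, 2, ?_⟩, ⟨1, 1, ?_⟩, ⟨0, 1, ?_⟩, trivial⟩ <;>
    simp only [one_mul, one_smul, mul_smul, smul_add, smul_neg, weyl_smul_nsmul,
      rii, rjj, rij, rji] <;> module
  · refine ⟨⟨0, 1, ?_⟩, ⟨1, 1, ?_⟩, ⟨3, 2, ?_⟩, ⟨2, 1, ?_⟩, ⟨3, 1, ?_⟩, ⟨1, 0, ?_⟩, trivial⟩ <;>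
    simp only [one_mul, one_smul, mul_smul, smul_add, smul_neg, weyl_smul_nsmul,
      rii, rjj, rij, rji] <;> module

end BraidRelations

/-! ### Independence of the reduced word -/

section Matsumoto

variable {ι X Y : Type*} [AddCommGroup X] [AddCommGroup Y] [Module.Free ℤ X] [Finite ι]
  {P : RootDatum ι X Y} [P.IsReduced] {b : P.Base}

/-- Two distinct simple roots have nonpositive Cartan integers, which leaves only the types A₁ × A₁,
A₂, B₂ and G₂, up to exchanging the roots. -/
theorem exists_isBraid {i j : b.support} (hne : i ≠ j) : ∃ c c', IsBraid b i j c c' := by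
  have hval : (i : ι) ≠ j := Subtype.coe_injective.ne hne
  have hmem := P.pairingIn_pairingIn_mem_set_of_isCrystal_of_isRed' i j
    (P.root.injective.ne hval) (b.root_ne_neg_of_ne i.2 j.2 hval)
  have h₁ := b.pairingIn_le_zero_of_ne hval i.2 j.2
  have e₁ : P.pairing i j = P.pairingIn ℤ i j := (P.algebraMap_pairingIn ℤ _ _).symm
  have e₂ : P.pairing j i = P.pairingIn ℤ j i := (P.algebraMap_pairingIn ℤ _ _).symm
  generalize P.pairingIn ℤ i j = p at *
  generalize P.pairingIn ℤ j i = q at *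
  simp only [Set.mem_insert_iff, Set.mem_singleton_iff, Prod.mk.injEq] at hmem
  rcases hmem with ⟨rfl, rfl⟩ | ⟨rfl, rfl⟩ | ⟨rfl, rfl⟩ | ⟨rfl, rfl⟩ | ⟨rfl, rfl⟩ | ⟨rfl, rfl⟩ |
    ⟨rfl, rfl⟩ | ⟨rfl, rfl⟩ | ⟨rfl, rfl⟩ | ⟨rfl, rfl⟩ | ⟨rfl, rfl⟩
  · exact ⟨_, _, isBraid_two (by simpa using e₂) (by simpa using e₁)⟩
  · omega
  · exact ⟨_, _, isBraid_three hne (by simpa using e₂) (by simpa using e₁)⟩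
  · omega
  · omega
  · exact ⟨_, _, isBraid_four hne (by simpa using e₂) (by simpa using e₁)⟩
  · exact ⟨_, _, (isBraid_four hne.symm (by simpa using e₁) (by simpa using e₂)).symm⟩
  · omega
  · omega
  · exact ⟨_, _, isBraid_six hne (by simpa using e₂) (by simpa using e₁)⟩
  · exact ⟨_, _, (isBraid_six hne.symm (by simpa using e₁) (by simpa using e₂)).symm⟩

omit [Module.Free ℤ X] in
theorem IsReducedWord.tail {i : b.support} {l : List b.support} {w : P.weylGroup}
    (h : IsReducedWord b (i :: l) w) :
    IsReducedWord b l (refl P i * w) ∧ ¬ b.IsPos (w⁻¹ • (i : ι)) := by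
  obtain ⟨rfl, hlen⟩ := h
  have h₁ := length_wordProd_le b l
  have h₂ := length_refl_mul_le b i (wordProd b l)
  rw [← wordProd_cons, ← hlen, List.length_cons] at h₂
  rw [List.length_cons] at hlen
  refine ⟨⟨by rw [wordProd_cons, refl_mul_refl_mul], ?_⟩, ?_⟩
  · rw [wordProd_cons, refl_mul_refl_mul]
    omega
  · apply not_isPos_of_length_refl_mul_lt
    rw [wordProd_cons, refl_mul_refl_mul, ← wordProd_cons]
    omega

/-- The operator `∂_w` does not depend on the reduced expression of `w`. -/
theorem demazure_eq_of_isReducedWord {l m : List b.support} {w : P.weylGroup}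
    (hl : IsReducedWord b l w) (hm : IsReducedWord b m w) : demazure b l = demazure b m := by
  induction h : l.length using Nat.strong_induction_on generalizing l m w with
  | _ n ih =>
  subst h
  have hlm : l.length = m.length := hl.2.trans hm.2.symm
  match l, m with
  | [], [] => rfl
  | i :: l, j :: m =>
    obtain ⟨hl', hi⟩ := hl.tail
    obtain ⟨hm', hj⟩ := hm.tail
    by_cases hij : i = j
    · subst hij
      rw [demazure_cons, demazure_cons, ih l.length (by simp) hl' hm' rfl]
    · obtain ⟨c, c', hc⟩ := exists_isBraid hij
      -- Both `α_i` and `α_j` are made negative by `w⁻¹`, so either braid word followed by the same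
      -- `r` is reduced for `w`. Induction on tails compares each given word with the one sharing
      -- its first letter, and the braid relation links these two.
      obtain ⟨r, hr, hrlen⟩ := exists_isReducedWord b ((wordProd b (i :: c))⁻¹ * w)
      have hlen := length_eq_of_inversionsNonneg b hi hj 1 _ hc.inversions_left
      rw [inv_one, one_mul, ← hrlen] at hlen
      have hred : IsReducedWord b (i :: (c ++ r)) w :=
        ⟨by rw [← List.cons_append, wordProd_append, hr, mul_inv_cancel_left],
          by rw [← List.cons_append, List.length_append, hlen]⟩
      have hred' : IsReducedWord b (j :: (c' ++ r)) w := by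
        refine ⟨?_, ?_⟩
        · rw [← List.cons_append, wordProd_append, hr, ← hc.wordProd_eq, mul_inv_cancel_left]
        · rw [hlen, ← List.cons_append]
          simp only [List.length_append, List.length_cons, hc.length_eq]
      calc demazure b (i :: l) = demazure b (i :: (c ++ r)) := by
            rw [demazure_cons, demazure_cons, ih l.length (by simp) hl' hred.tail.1 rfl]
        _ = demazure b (i :: c) * demazure b r := by rw [← List.cons_append, demazure_append]
        _ = demazure b (j :: c') * demazure b r := by rw [hc.demazure_eq]
        _ = demazure b (j :: (c' ++ r)) := by rw [← List.cons_append, demazure_append]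
        _ = demazure b (j :: m) := by
            rw [demazure_cons, demazure_cons,
              ih m.length (by simpa using hlm.ge) hm' hred'.tail.1 rfl]

end Matsumoto

/-! ### Invariance of the image of `∂_{w₀}` -/

section Longest

variable {ι X Y : Type*} [AddCommGroup X] [AddCommGroup Y] [Module.Free ℤ X]
  {P : RootDatum ι X Y}

omit [Module.Free ℤ X] in
theorem weylAct_mul_apply (v w : P.weylGroup) (u : CharRing X) :
    weylAct P (v * w) u = weylAct P v (weylAct P w u) := by
  rw [map_mul, AlgHom.mul_apply]

/-- The image of `δ_a` is fixed by `s_a`. -/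
theorem weylAct_refl_divDiff (i : ι) (u : CharRing X) :
    weylAct P (refl P i) (divDiff P i u) = divDiff P i u := by
  have h := denom_mul_divDiff P i u
  have h' := congrArg (weylAct P (refl P i)) h
  have hs : refl P i • (-P.root i) = P.root i := by
    rw [smul_neg, refl_smul_root_self, neg_neg]
  rw [map_mul, map_sub, map_one, weylAct_ex, map_sub, map_mul, weylAct_ex, hs,
    ← weylAct_mul_apply, refl_mul_self, map_one, AlgHom.one_apply] at h'
  have he : ex (-P.root i) * ex (P.root i) = 1 := by
    rw [← ex_add, neg_add_cancel, ex_zero]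
  apply denom_cancel P i
  -- Applying `s_a` to the defining equation and multiplying by `-e^{-a}` gives that equation back
  -- with `s_a(v)` in place of `v = δ_a(u)`.
  linear_combination (-(ex (-P.root i))) * h' - h -
    (weylAct P (refl P i) (divDiff P i u) - u) * he

theorem divDiff_one (i : ι) : divDiff P i 1 = 1 := by
  apply denom_cancel P i
  rw [denom_mul_divDiff, map_one, mul_one, mul_one]

theorem demazure_one (b : P.Base) (l : List b.support) : (demazure b l : EndRing P) 1 = 1 := by
  induction l with
  | nil => rfl
  | cons i l ih => rw [demazure_cons_apply, ih, divDiff_one]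

variable [Finite ι] [P.IsReduced] {b : P.Base}

/-- The image of `∂_{w₀}` consists of Weyl invariants. -/
theorem demazure_mem_invariantRing {w₀ : P.weylGroup} (hw₀ : IsLongest b w₀)
    {l : List b.support} (hl : IsReducedWord b l w₀) (u : CharRing X) :
    (demazure b l : EndRing P) u ∈ invariantRing P := by
  have hrefl (i : b.support) : weylAct P (refl P i) ((demazure b l : EndRing P) u) =
      (demazure b l : EndRing P) u := by
    -- As `s_i w₀` is not longer than `w₀`, it is shorter by exactly one, so prefixing `i` to a
    -- reduced word of it gives a reduced word of `w₀`.
    obtain ⟨m, hm, hlen⟩ := exists_isReducedWord b (refl P i * w₀)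
    have hred : IsReducedWord b (i :: m) w₀ := by
      refine ⟨by rw [wordProd_cons, hm, refl_mul_refl_mul], ?_⟩
      rw [List.length_cons, hlen, ← length_refl_mul_of_not_isPos b
        (not_isPos_of_length_refl_mul_lt b (hw₀ _))]
    rw [demazure_eq_of_isReducedWord hl hred, demazure_cons_apply, weylAct_refl_divDiff]
  intro w
  obtain ⟨m, rfl⟩ := exists_wordProd_eq b w
  induction m with
  | nil => rw [wordProd_nil, map_one, AlgHom.one_apply]
  | cons i m ih => rw [wordProd_cons, weylAct_mul_apply, ih, hrefl]

end Longest

/-! ### The left ideals `I(D)` and `J` -/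

section Projection

variable {ι X Y : Type*} [AddCommGroup X] [AddCommGroup Y] [Module.Free ℤ X]
  {P : RootDatum ι X Y}

theorem mem_augIdeal {Δ : hecke P} : Δ ∈ augIdeal P ↔ (Δ : EndRing P) 1 = 0 := Iff.rfl

theorem one_sub_weylD_mem_augIdeal (w : P.weylGroup) : 1 - weylD P w ∈ augIdeal P := by
  change (1 : CharRing X) - weylAct P w 1 = 0
  rw [map_one, sub_self]

theorem mul_eq_zero_of_mem_augIdeal {Δ p : hecke P} (hΔ : Δ ∈ augIdeal P)
    (hp : ∀ u, (p : EndRing P) u ∈ invariantRing P) : Δ * p = 0 := by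
  refine Subtype.ext (LinearMap.ext fun u => ?_)
  change (Δ : EndRing P) ((p : EndRing P) u) = 0
  have h : (p : EndRing P) u = (⟨_, hp u⟩ : invariantRing P) • (1 : CharRing X) := by
    rw [Subalgebra.smul_def, smul_eq_mul, mul_one]
  rw [h, map_smul, mem_augIdeal.mp hΔ, smul_zero]

theorem groupAugIdeal_eq_span (W : Type*) [Group W] :
    (groupAugIdeal W : Set (MonoidAlgebra ℤ W)) =
      Submodule.span ℤ (Set.range fun w : W => 1 - MonoidAlgebra.of ℤ W w) := by
  ext x
  constructor
  · intro hx
    have hx' : MonoidAlgebra.lift ℤ ℤ W (1 : W →* ℤ) x = 0 := hx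
    -- The difference `ε(y) - y` is additive in `y` and equals `1 - w` at `y = w`; on the
    -- augmentation ideal it is `-y`.
    have key (y : MonoidAlgebra ℤ W) :
        algebraMap ℤ _ (MonoidAlgebra.lift ℤ ℤ W (1 : W →* ℤ) y) - y ∈
          Submodule.span ℤ (Set.range fun w : W => 1 - MonoidAlgebra.of ℤ W w) := by
      induction y using MonoidAlgebra.induction_on with
      | of w =>
        rw [MonoidAlgebra.lift_of, MonoidHom.one_apply, map_one]
        exact Submodule.subset_span ⟨w, rfl⟩
      | add f g hf hg =>
        rw [map_add, map_add, add_sub_add_comm]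
        exact add_mem hf hg
      | smul r f hf =>
        rw [map_smul, smul_eq_mul, map_mul, ← Algebra.smul_def, ← smul_sub]
        exact Submodule.smul_mem _ _ hf
    have h := key x
    rw [hx', map_zero, zero_sub, neg_mem_iff] at h
    exact h
  · intro hx
    change MonoidAlgebra.lift ℤ ℤ W (1 : W →* ℤ) x = 0
    induction hx using Submodule.span_induction with
    | mem y hy =>
      obtain ⟨w, rfl⟩ := hy
      rw [map_sub, map_one, MonoidAlgebra.lift_of, MonoidHom.one_apply, sub_self]
    | zero => exact map_zero _
    | add y z _ _ hy hz => rw [map_add, hy, hz, add_zero]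
    | smul r y _ hy => rw [map_smul, hy, smul_zero]

theorem idealJ_eq_span (p : hecke P) :
    idealJ P p = Ideal.span ({p} ∪ groupRingD P ''
      (groupAugIdeal P.weylGroup : Set (MonoidAlgebra ℤ P.weylGroup))) := by
  rw [idealJ, Ideal.span_union]
  congr 1
  have hof (w : P.weylGroup) : groupRingD P (1 - MonoidAlgebra.of ℤ _ w) = 1 - weylD P w := by
    rw [map_sub, map_one, groupRingD, MonoidAlgebra.lift_of]
  apply le_antisymm
  · refine iSup_le fun w => Ideal.span_le.mpr (Set.singleton_subset_iff.mpr ?_)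
    refine Ideal.subset_span ⟨1 - MonoidAlgebra.of ℤ _ w, ?_, hof w⟩
    rw [groupAugIdeal_eq_span]
    exact Submodule.subset_span ⟨w, rfl⟩
  · rw [Ideal.span_le, groupAugIdeal_eq_span]
    rintro _ ⟨x, hx, rfl⟩
    rw [SetLike.mem_coe] at hx ⊢
    induction hx using Submodule.span_induction with
    | mem y hy =>
      obtain ⟨w, rfl⟩ := hy
      rw [hof]
      exact Ideal.mem_iSup_of_mem w (Ideal.mem_span_singleton_self _)
    | zero => rw [map_zero]; exact zero_mem _
    | add y z _ _ hy hz => rw [map_add]; exact add_mem hy hz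
    | smul r y _ hy => rw [map_smul]; exact Submodule.smul_of_tower_mem _ r hy

theorem one_sub_smul_hecke {A : Type*} [AddCommGroup A] [Module (hecke P) A] (Δ : hecke P)
    (a : A) : (1 - Δ) • a = a - Δ • a :=
  eq_sub_of_add_eq (by rw [← add_smul, show 1 - Δ + Δ = 1 from sub_add_cancel 1 Δ, one_smul])

theorem mem_annihilatedBy_idealJ {A : Type*} [AddCommGroup A] [Module (hecke P) A]
    [Module (invariantRing P) A] [IsScalarTower (invariantRing P) (hecke P) A] {p : hecke P}
    {a : A} : a ∈ annihilatedBy P (idealJ P p) A ↔ p • a = 0 ∧ a ∈ weylInvariants P A := by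
  constructor
  · intro h
    refine ⟨h p (Ideal.mem_sup_left (Ideal.mem_span_singleton_self p)), fun w => ?_⟩
    have hw := h (1 - weylD P w) (Ideal.mem_sup_right
      (Ideal.mem_iSup_of_mem w (Ideal.mem_span_singleton_self _)))
    rw [one_sub_smul_hecke, sub_eq_zero] at hw
    exact hw.symm
  · rintro ⟨hp, hW⟩
    -- The annihilator of `a` is a left ideal, so only the generators of `J` need checking.
    suffices idealJ P p ≤ LinearMap.ker (LinearMap.toSpanSingleton (hecke P) A a) from
      fun Δ hΔ => this hΔ
    refine sup_le ?_ (iSup_le fun w => ?_)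
    · exact Ideal.span_le.mpr (Set.singleton_subset_iff.mpr hp)
    · refine Ideal.span_le.mpr (Set.singleton_subset_iff.mpr ?_)
      change (1 - weylD P w) • a = 0
      rw [one_sub_smul_hecke, hW w, sub_self]

end Projection

end DemazureHecke

end

/-! ### The projection and the decomposition of `A^W` -/

theorem mainTheorem8 {ι X Y : Type*} [Finite ι] [AddCommGroup X] [AddCommGroup Y]
    [Module.Free ℤ X] [Module.Finite ℤ X] [Module.Finite ℤ Y]
    (P : RootDatum ι X Y) [P.IsReduced] (b : P.Base)
    (w₀ : P.weylGroup) (hw₀ : DemazureHecke.IsLongest b w₀)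
    (l : List b.support) (hl : DemazureHecke.IsReducedWord b l w₀) :
    (DemazureHecke.demazure b l : DemazureHecke.EndRing P) 1 = 1 ∧
    ∀ u₀ : DemazureHecke.CharRing X,
      (DemazureHecke.demazure b l : DemazureHecke.EndRing P) u₀ = 1 →
      DemazureHecke.idealJ P (DemazureHecke.projOp b l u₀) =
        Ideal.span ({DemazureHecke.projOp b l u₀} ∪ DemazureHecke.groupRingD P ''
          (DemazureHecke.groupAugIdeal P.weylGroup : Set (MonoidAlgebra ℤ P.weylGroup))) ∧
      ∀ (A : Type*) [AddCommGroup A] [Module (DemazureHecke.hecke P) A]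
        [Module (DemazureHecke.invariantRing P) A]
        [IsScalarTower (DemazureHecke.invariantRing P) (DemazureHecke.hecke P) A],
        LinearMap.IsProj (DemazureHecke.annihilatedBy P (DemazureHecke.augIdeal P) A)
          (Algebra.lsmul (DemazureHecke.invariantRing P) (DemazureHecke.invariantRing P) A
            (DemazureHecke.projOp b l u₀)) ∧
        (Disjoint (DemazureHecke.annihilatedBy P (DemazureHecke.augIdeal P) A)
            (DemazureHecke.annihilatedBy P
              (DemazureHecke.idealJ P (DemazureHecke.projOp b l u₀)) A) ∧
          DemazureHecke.annihilatedBy P (DemazureHecke.augIdeal P) A ⊔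
            DemazureHecke.annihilatedBy P
              (DemazureHecke.idealJ P (DemazureHecke.projOp b l u₀)) A =
              DemazureHecke.weylInvariants P A) ∧
        (DemazureHecke.weylInvariants P A =
            DemazureHecke.annihilatedBy P (DemazureHecke.augIdeal P) A ↔
          DemazureHecke.annihilatedBy P
            (DemazureHecke.idealJ P (DemazureHecke.projOp b l u₀)) A = ⊥) := by
  have hinv := DemazureHecke.demazure_mem_invariantRing hw₀ hl
  refine ⟨DemazureHecke.demazure_one b l, fun u₀ hu₀ => ⟨DemazureHecke.idealJ_eq_span _, ?_⟩⟩
  intro A _ _ _ _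
  set p := DemazureHecke.projOp b l u₀
  have hp (a : A) : p • a ∈ DemazureHecke.annihilatedBy P (DemazureHecke.augIdeal P) A := by
    intro Δ hΔ
    rw [smul_smul, DemazureHecke.mul_eq_zero_of_mem_augIdeal hΔ fun u => hinv (u₀ * u), zero_smul]
  have hfix (a : A) (ha : a ∈ DemazureHecke.annihilatedBy P (DemazureHecke.augIdeal P) A) :
      p • a = a := by
    have h1 : 1 - p ∈ DemazureHecke.augIdeal P := by
      change (1 : DemazureHecke.CharRing X) - (p : DemazureHecke.EndRing P) 1 = 0
      rw [DemazureHecke.projOp_apply, mul_one, hu₀, sub_self]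
    have h2 := ha _ h1
    rw [DemazureHecke.one_sub_smul_hecke, sub_eq_zero] at h2
    exact h2.symm
  have hJ (a : A) : a ∈ DemazureHecke.annihilatedBy P (DemazureHecke.idealJ P p) A ↔
      p • a = 0 ∧ a ∈ DemazureHecke.weylInvariants P A :=
    DemazureHecke.mem_annihilatedBy_idealJ
  have haug : DemazureHecke.annihilatedBy P (DemazureHecke.augIdeal P) A ≤
      DemazureHecke.weylInvariants P A := by
    intro a ha w
    have h := ha _ (DemazureHecke.one_sub_weylD_mem_augIdeal w)
    rw [DemazureHecke.one_sub_smul_hecke, sub_eq_zero] at h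
    exact h.symm
  have hdisj : Disjoint (DemazureHecke.annihilatedBy P (DemazureHecke.augIdeal P) A)
      (DemazureHecke.annihilatedBy P (DemazureHecke.idealJ P p) A) := by
    rw [Submodule.disjoint_def]
    intro a ha haJ
    rw [← hfix a ha, ((hJ a).mp haJ).1]
  have hsup : DemazureHecke.annihilatedBy P (DemazureHecke.augIdeal P) A ⊔
      DemazureHecke.annihilatedBy P (DemazureHecke.idealJ P p) A =
        DemazureHecke.weylInvariants P A := by
    refine le_antisymm (sup_le haug fun a ha => ((hJ a).mp ha).2) fun a ha => ?_
    rw [← add_sub_cancel (p • a) a]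
    refine Submodule.add_mem_sup (hp a) ((hJ _).mpr ⟨?_, sub_mem ha (haug (hp a))⟩)
    rw [smul_sub, hfix _ (hp a), sub_self]
  refine ⟨⟨hp, hfix⟩, ⟨hdisj, hsup⟩, fun h => ?_, fun h => ?_⟩
  · rw [h, sup_eq_left] at hsup
    exact hdisj.eq_bot_of_ge hsup
  · rw [← hsup, h, sup_bot_eq]
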